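/- Let $\mathbb D=\{|z|<1\}$, $\mathbb T=\{|z|=1\}$, let $m$ be normalized Lebesgue measure on $\mathbb T$, and let $H^\infty$ be the set of bounded holomorphic functions on $\mathbb D$ with $\|f\|_\infty=\sup_{\mathbb D}|f|$. **Definitions.** A function $\theta\in H^\infty$ is *inner* if $\lim_{r\to1^-}|\theta(r\zeta)|=1$ for $m$-almost every $\zeta\in\mathbb T$. A zero-free holomorphic function $F$ on $\mathbb D$ is *outer* if $\log|F|$ is the Poisson integral of a function in $L^1(\mathbb T,m)$. The *Smirnov class* $\mathcal N^+$ is the set of quotients $u/v$ with $u,v\in H^\infty$ and $v$ outer. An inner function $J$ is the *inner factor* of $g\in\mathcal N^+$, $g\not\equiv0$, if $g=JG$ on $\mathbb D$ with $G$ outer (this determines $J$ up to a unimodular constant); it is *nontrivial* if it is nonconstant. The *boundary spectrum* $\sigma(J)$ is the set of points of $\mathbb T$ across which $J$ has no analytic continuation. The disk algebra $\mathcal A$ is the set of holomorphic functions on $\mathbb D$ that extend continuously to $\overline{\mathbb D}$. For a sequence $\{a_j\}\subset\mathbb D$ with $\sum_j(1-|a_j|)<\infty$, the *Blaschke product* with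 zeros $\{a_j\}$ is $$B_{\{a_j\}}(z)=\prod_j\frac{|a_j|}{a_j}\,\frac{a_j-z}{1-\overline{a_j}z},\qquad z\in\mathbb D$$ (with $|a_j|/a_j:=-1$ if $a_j=0$). A sequence $\{z_n\}_{n\in\mathbb N}\subset\mathbb D$ is *thick* if it is not the case that $$\lim_{k\to\infty}\prod_{j\ne k}\left|\frac{z_j-z_k}{1-\overline{z_j}z_k}\right|=1 .$$ **Theorem 1.4.** Let $\mathcal E=\{e^{it}:0\le t\le t_0\}$, where $0<t_0\le\pi$, and let $F\in H^\infty$ be an outer function such that $\|F\|_\infty=1$, $F'\in\mathcal A$, and $|F|=1$ on $\mathcal E$ (in the sense of boundary values). Further, suppose $\{z_n\}_{n\in\mathbb N}\subset\mathbb D$ is a thick sequence such that $\operatorname{Im}z_n>0$ for all $n$, $\lim_{n\to\infty}z_n=1$ and $$\sum_n\frac{1-|z_n|^2}{|1-z_n|^2}<\infty .$$ Finally, assume that the Blaschke product $B=B_{\{z_n\}}$ satisfies $B'\in\mathcal N^+$, and put $f:=BF$. Then $f'\in\mathcal N^+$, and $f'$ has a nontrivial inner factor $J$ with $1\in\sigma(J)$.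 -/

import Mathlib

open Filter Topology Metric MeasureTheory

noncomputable section

namespace DiskFun

/-- The open unit disk. Functions on the disk are represented by functions on the whole complex
plane of which only the values on the disk matter. -/
def disk : Set ℂ := ball 0 1

/-- Bounded holomorphic functions on the unit disk. -/
def IsHInfty (f : ℂ → ℂ) : Prop :=
  DifferentiableOn ℂ f disk ∧ ∃ C : ℝ, ∀ w ∈ disk, ‖f w‖ ≤ C

/-- The supremum norm over the disk equals `M`. -/
def HasSupNorm (f : ℂ → ℂ) (M : ℝ) : Prop :=
  IsLUB ((fun w => ‖f w‖) '' disk) M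

/-- Inner functions: bounded holomorphic functions whose radial limits have modulus one almost
everywhere on the circle (parametrized by the angle). -/
def IsInner (θ : ℂ → ℂ) : Prop :=
  IsHInfty θ ∧
    ∀ᵐ t : ℝ, Tendsto (fun r : ℝ => ‖θ (r * Complex.exp (t * Complex.I))‖) (𝓝[<] 1) (𝓝 1)

/-- Outer functions: zero-free holomorphic functions such that `log |F|` is the Poisson integral
of an integrable function on the circle (with respect to normalized Lebesgue measure). -/
def IsOuter (F : ℂ → ℂ) : Prop :=
  DifferentiableOn ℂ F disk ∧ (∀ w ∈ disk, F w ≠ 0) ∧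
    ∃ u : ℂ → ℝ, CircleIntegrable u 0 1 ∧
      ∀ w ∈ disk, Real.log ‖F w‖ =
        Real.circleAverage (fun ζ => poissonKernel 0 w ζ * u ζ) 0 1

/-- The Smirnov class: quotients of two bounded holomorphic functions with outer denominator. -/
def IsSmirnov (f : ℂ → ℂ) : Prop :=
  ∃ u v : ℂ → ℂ, IsHInfty u ∧ IsHInfty v ∧ IsOuter v ∧ ∀ w ∈ disk, f w = u w / v w

/-- `J` is the inner factor of `f` (determined up to a unimodular constant): `J` is inner and
`f = J G` on the disk for some outer function `G`. -/
def IsInnerFactor (J f : ℂ → ℂ) : Prop :=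
  IsInner J ∧ ∃ G : ℂ → ℂ, IsOuter G ∧ ∀ w ∈ disk, f w = J w * G w

/-- The function is not constant on the disk. -/
def IsNonconstant (f : ℂ → ℂ) : Prop :=
  ¬ ∃ c : ℂ, ∀ w ∈ disk, f w = c

/-- The disk algebra: holomorphic functions on the disk with a continuous extension to the
closed disk. -/
def InDiskAlgebra (f : ℂ → ℂ) : Prop :=
  DifferentiableOn ℂ f disk ∧
    ∃ g : ℂ → ℂ, ContinuousOn g (closedBall 0 1) ∧ ∀ w ∈ disk, g w = f w

/-- The boundary spectrum: the points of the unit circle across which the function has no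
analytic continuation. -/
def boundarySpectrum (θ : ℂ → ℂ) : Set ℂ :=
  {ζ | ‖ζ‖ = 1 ∧ ¬ ∃ g : ℂ → ℂ, AnalyticAt ℂ g ζ ∧ g =ᶠ[𝓝[disk] ζ] θ}

/-- The Blaschke factor with zero `a`; for `a = 0` the factor `|a| / a` is read as `-1`. -/
def blaschkeFactor (a w : ℂ) : ℂ :=
  (if a = 0 then -1 else (‖a‖ : ℂ) / a) * ((a - w) / (1 - (starRingEnd ℂ) a * w))

/-- The Blaschke product with zero sequence `z`, zeros being repeated as in the sequence. -/
def blaschkeProduct (z : ℕ → ℂ) (w : ℂ) : ℂ :=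
  ∏' n, blaschkeFactor (z n) w

/-- The pseudohyperbolic distance on the disk. -/
def pseudoDist (a b : ℂ) : ℝ :=
  ‖(a - b) / (1 - (starRingEnd ℂ) a * b)‖

/-- A sequence in the disk is thin if the product over `j ≠ k` of the pseudohyperbolic distances
from `z j` to `z k` tends to one as `k → ∞`. -/
def IsThin (z : ℕ → ℂ) : Prop :=
  Tendsto (fun k => ∏' j : {j : ℕ // j ≠ k}, pseudoDist (z j) (z k)) atTop (𝓝 1)

/-- Thick sequences are those that are not thin. -/
def IsThick (z : ℕ → ℂ) : Prop := ¬ IsThin z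

end DiskFun

end

/-!
# The inner factor of the derivative of `B F`

Write `f = B F`, and let `P_a` denote the Poisson kernel with pole at `a`. As `B'` is in the Smirnov
class and `F'` is bounded, `f' = B' F + B F'` is in the Smirnov class. So it has an inner-outer
factorization `f' = J G`, where `log |G|` is the Poisson integral of some `ω` and `|f'|` has radial
limits `exp ω` almost everywhere. The inner factor is compared with the numbers
`p_k = ∏_{j ≠ k} ρ(z_j, z_k)`, where `ρ` is the pseudohyperbolic distance. They do not tend to `1`
because the sequence is thick.

* *Upper bound for `f'` at the zeros.* Splitting off the `k`-th Blaschke factor gives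
  `(1 - |z_k|²) |f'(z_k)| = p_k |F(z_k)| ≤ p_k` (`norm_deriv_blaschkeFactor_mul`).
* *Lower bound for `ω` on the arc.* At interior points of the arc, `|f|` has radial limit `1`
  (`tendsto_norm_blaschkeProduct`), while `|f|` is at most the modulus of the `k`-th Blaschke factor.
  Comparing `1 - |f|` with both along the radius yields `exp ω ≥ P_{z_k}` almost everywhere on the
  arc (`poissonKernel_le_of_radial`).
* *Lower bound for `G` at the zeros.* On the circle, `log P_a` is the boundary function of a harmonic
  function with value `-log (1 - |a|²)` at `a` (`poissonIntegral_log_poissonKernel`). The zeros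
  approach `1` tangentially from the side of the arc, and `P_{z_k}` tends to zero uniformly off the
  arc (`exists_mul_norm_one_sub_le`). So the part of the circle off the arc contributes a negligible
  amount, and `(1 - |z_k|²) |G(z_k)| ≥ 1 - o(1)` (`neg_log_sub_le_poissonIntegral`).

Together, `|J(z_k)| (1 - o(1)) ≤ p_k ≤ 1`. If `J` had an analytic continuation across `1`, then
`|J(z_k)|` would tend to `1` (`IsInner.tendsto_norm_of_continuation`), and so would `p_k`. Hence `1`
is in the boundary spectrum of `J`, and in particular `J` is not constant.

The existence of the inner-outer factorization rests on the following theory.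

* Fatou's theorem on radial limits of Poisson integrals of integrable functions
  (`ae_tendsto_poissonIntegral`), from a layer-cake estimate at Lebesgue points.
* A bounded holomorphic function is the Poisson integral of its boundary function, obtained from weak
  compactness in `L²` (`IsHInfty.exists_poissonIntegral_eq`). This gives a maximum principle for
  radial limits (`IsHInfty.norm_le_of_radial`).
* For `f` bounded with boundary function `u`, the outer function with boundary modulus
  `max |u| ε` dominates `f` by that maximum principle. As `ε` tends to zero, integrability of
  `log |u|` and `log |f| ≤ P[log |u|]` follow (`IsHInfty.log_integrable_of_radial`) without recourse
  to Jensen's formula, and `f` divided by the outer function with boundary modulus `|u|` is inner.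
-/

namespace DiskFun

open Set Real

/-! ### A layer-cake estimate for bell-shaped kernels -/

/-- Let `K` be nonnegative and decreasing in `|x|`. If the averages of `h` over the balls around the
origin of radius at most `δ` are bounded by `ε`, then `∫ K h` is at most `ε ∫ K`, up to the tail
contribution `K δ ∫ h`. The superlevel sets of `K` are intervals centered at the origin, so this is
the layer-cake formula for `K` with respect to the measure with density `h`. -/
theorem lintegral_mul_le_of_antitone_abs {a δ : ℝ} (hδ : 0 < δ) (hδa : δ < a)
    {K : ℝ → ℝ} (hK0 : ∀ x, 0 ≤ K x) (hKm : Measurable K)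
    (hK : ∀ x ∈ Ioo (-a) a, ∀ y ∈ Ioo (-a) a, |x| ≤ |y| → K y ≤ K x)
    {h : ℝ → ENNReal} (hh : AEMeasurable h (volume.restrict (Ioo (-a) a))) {ε : ENNReal}
    (hε : ∀ ρ, 0 < ρ → ρ ≤ δ → ∫⁻ x in closedBall 0 ρ, h x ≤ ε * volume (closedBall (0 : ℝ) ρ)) :
    ∫⁻ x in Ioo (-a) a, ENNReal.ofReal (K x) * h x ≤
      ε * (∫⁻ x in Ioo (-a) a, ENNReal.ofReal (K x)) +
        ENNReal.ofReal (K δ) * ∫⁻ x in Ioo (-a) a, h x := by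
  set μ : Measure ℝ := volume.restrict (Ioo (-a) a) with hμ
  set ν : Measure ℝ := μ.withDensity h with hν
  have hKo : Measurable fun x => ENNReal.ofReal (K x) := hKm.ennreal_ofReal
  have hν_univ : ν univ = ∫⁻ x, h x ∂μ := by
    rw [hν, withDensity_apply _ MeasurableSet.univ, Measure.restrict_univ]
  have hlhs : ∫⁻ x, ENNReal.ofReal (K x) * h x ∂μ = ∫⁻ x, ENNReal.ofReal (K x) ∂ν := by
    rw [hν, lintegral_withDensity_eq_lintegral_mul₀ hh hKo.aemeasurable]
    simp [mul_comm]
  rw [hlhs, lintegral_eq_lintegral_meas_lt ν (Eventually.of_forall hK0) hKm.aemeasurable,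
    lintegral_eq_lintegral_meas_lt μ (Eventually.of_forall hK0) hKm.aemeasurable, ← hν_univ]
  have key : ∀ t ∈ Ioi (0 : ℝ), ν {x | t < K x} ≤
      ε * μ {x | t < K x} + (Iio (K δ)).indicator (fun _ => ν univ) t := by
    intro t _
    by_cases htδ : t < K δ
    · rw [indicator_of_mem (show t ∈ Iio (K δ) from htδ)]
      exact (measure_mono (subset_univ _)).trans le_add_self
    rw [indicator_of_notMem (show t ∉ Iio (K δ) from htδ), add_zero]
    have hms : MeasurableSet {x | t < K x} := measurableSet_lt measurable_const hKm
    set S : Set ℝ := {x | t < K x} ∩ Ioo (-a) a with hS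
    have hμS : μ {x | t < K x} = volume S := by rw [hμ, Measure.restrict_apply hms]
    have hνS : ν {x | t < K x} = ∫⁻ x in S, h x := by
      rw [hν, withDensity_apply _ hms, hμ, Measure.restrict_restrict hms]
    rw [hμS, hνS]
    rcases S.eq_empty_or_nonempty with hSe | hSne
    · simp [hSe]
    have hδmem : δ ∈ Ioo (-a) a := ⟨by linarith, hδa⟩
    have hSδ : ∀ x ∈ S, |x| < δ := by
      rintro x ⟨hx, hxa⟩
      by_contra hcon
      push Not at hcon
      have := hK δ hδmem x hxa (by rwa [abs_of_pos hδ])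
      exact htδ (lt_of_lt_of_le hx this)
    set A : Set ℝ := (fun x => |x|) '' S with hA
    have hAne : A.Nonempty := hSne.image _
    have hAb : BddAbove A := ⟨δ, by rintro _ ⟨x, hx, rfl⟩; exact (hSδ x hx).le⟩
    set ρ := sSup A with hρ
    have hρδ : ρ ≤ δ := csSup_le hAne (by rintro _ ⟨x, hx, rfl⟩; exact (hSδ x hx).le)
    have hSsub : S ⊆ closedBall 0 ρ := by
      intro x hx
      rw [mem_closedBall_zero_iff, Real.norm_eq_abs]
      exact le_csSup hAb ⟨x, hx, rfl⟩
    have hsubS : ball 0 ρ ⊆ S := by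
      intro x hx
      rw [mem_ball_zero_iff, Real.norm_eq_abs] at hx
      obtain ⟨_, ⟨y, hy, rfl⟩, hxy⟩ := exists_lt_of_lt_csSup hAne hx
      have hxa : x ∈ Ioo (-a) a := abs_lt.1 (hx.trans_le (hρδ.trans hδa.le))
      exact ⟨lt_of_lt_of_le hy.1 (hK x hxa y hy.2 hxy.le), hxa⟩
    have hρ0 : 0 ≤ ρ := by
      obtain ⟨x, hx⟩ := hSne
      exact (abs_nonneg x).trans (le_csSup hAb ⟨x, hx, rfl⟩)
    rcases hρ0.eq_or_lt with h0 | hρpos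
    · have : volume S = 0 := measure_mono_null hSsub (by simp [← h0])
      rw [setLIntegral_measure_zero _ _ this]
      exact zero_le
    calc ∫⁻ x in S, h x ≤ ∫⁻ x in closedBall 0 ρ, h x := lintegral_mono_set hSsub
      _ ≤ ε * volume (closedBall (0 : ℝ) ρ) := hε ρ hρpos hρδ
      _ = ε * volume (ball (0 : ℝ) ρ) := by rw [Real.volume_closedBall, Real.volume_ball]
      _ ≤ ε * volume S := by gcongr
  calc ∫⁻ t in Ioi (0 : ℝ), ν {x | t < K x}
      ≤ ∫⁻ t in Ioi (0 : ℝ),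
          (ε * μ {x | t < K x} + (Iio (K δ)).indicator (fun _ => ν univ) t) :=
        setLIntegral_mono' measurableSet_Ioi key
    _ = (∫⁻ t in Ioi (0 : ℝ), ε * μ {x | t < K x}) +
          ∫⁻ t in Ioi (0 : ℝ), (Iio (K δ)).indicator (fun _ => ν univ) t :=
        lintegral_add_right _ (measurable_const.indicator measurableSet_Iio)
    _ = _ := by
        congr 1
        · refine lintegral_const_mul _ ?_
          exact Antitone.measurable fun s t hst => measure_mono fun x hx => lt_of_le_of_lt hst hx
        · rw [lintegral_indicator measurableSet_Iio, setLIntegral_const,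
            Measure.restrict_apply measurableSet_Iio, Iio_inter_Ioi, Real.volume_Ioo, sub_zero,
            mul_comm]

/-! ### Poisson integrals -/

section PoissonIntegral

variable {E : Type*} [NormedAddCommGroup E] [NormedSpace ℝ E]

/-- The Poisson integral over the unit circle, with respect to normalized arc length. Only the
values of `u` on the circle matter. -/
noncomputable def poissonIntegral (u : ℂ → E) (w : ℂ) : E :=
  circleAverage (fun ζ => poissonKernel 0 w ζ • u ζ) 0 1

theorem mem_disk {w : ℂ} : w ∈ disk ↔ ‖w‖ < 1 := mem_ball_zero_iff

theorem isOpen_disk : IsOpen disk := isOpen_ball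

theorem circleMap_mem_disk {r : ℝ} (hr0 : 0 ≤ r) (hr1 : r < 1) (t : ℝ) :
    circleMap 0 r t ∈ disk := by
  rw [mem_disk, norm_circleMap_zero, abs_of_nonneg hr0]
  exact hr1

theorem norm_circleMap_zero_one (t : ℝ) : ‖circleMap 0 1 t‖ = 1 := by simp

theorem poissonKernel_circleMap (w : ℂ) (t : ℝ) :
    poissonKernel 0 w (circleMap 0 1 t) = (1 - ‖w‖ ^ 2) / ‖circleMap 0 1 t - w‖ ^ 2 := by
  simp [poissonKernel_def]

theorem norm_circleMap_sub_pos {w : ℂ} (hw : w ∈ disk) (t : ℝ) : 0 < ‖circleMap 0 1 t - w‖ := by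
  rw [norm_pos_iff, sub_ne_zero]
  rintro h
  have := mem_disk.1 hw
  rw [← h, norm_circleMap_zero_one] at this
  exact lt_irrefl _ this

theorem one_sub_norm_sq_pos {w : ℂ} (hw : w ∈ disk) : 0 < 1 - ‖w‖ ^ 2 := by
  have := mem_disk.1 hw
  have h0 := norm_nonneg w
  nlinarith

theorem poissonKernel_circleMap_pos {w : ℂ} (hw : w ∈ disk) (t : ℝ) :
    0 < poissonKernel 0 w (circleMap 0 1 t) := by
  rw [poissonKernel_circleMap]
  have := norm_circleMap_sub_pos hw t
  have := one_sub_norm_sq_pos hw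
  positivity

theorem continuous_poissonKernel_circleMap {w : ℂ} (hw : w ∈ disk) :
    Continuous fun t => poissonKernel 0 w (circleMap 0 1 t) := by
  simp_rw [poissonKernel_circleMap]
  have := continuous_circleMap 0 1
  exact continuous_const.div (by fun_prop) fun t => (pow_pos (norm_circleMap_sub_pos hw t) 2).ne'

theorem exists_poissonKernel_le {w : ℂ} (hw : w ∈ disk) :
    ∃ C : ℝ, 0 < C ∧ ∀ t, poissonKernel 0 w (circleMap 0 1 t) ≤ C := by
  have h1 := mem_disk.1 hw
  have h2 := one_sub_norm_sq_pos hw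
  have h3 : 0 < 1 - ‖w‖ := by linarith
  refine ⟨(1 - ‖w‖ ^ 2) / (1 - ‖w‖) ^ 2, by positivity, fun t => ?_⟩
  rw [poissonKernel_circleMap]
  gcongr
  calc 1 - ‖w‖ = ‖circleMap 0 1 t‖ - ‖w‖ := by rw [norm_circleMap_zero_one]
    _ ≤ _ := norm_sub_norm_le _ _

theorem exists_le_poissonKernel {w : ℂ} (hw : w ∈ disk) :
    ∃ c : ℝ, 0 < c ∧ ∀ t, c ≤ poissonKernel 0 w (circleMap 0 1 t) := by
  have h2 := one_sub_norm_sq_pos hw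
  refine ⟨(1 - ‖w‖ ^ 2) / (1 + ‖w‖) ^ 2, by positivity, fun t => ?_⟩
  rw [poissonKernel_circleMap]
  have := norm_circleMap_sub_pos hw t
  gcongr
  calc ‖circleMap 0 1 t - w‖ ≤ ‖circleMap 0 1 t‖ + ‖w‖ := norm_sub_le _ _
    _ = 1 + ‖w‖ := by rw [norm_circleMap_zero_one]

theorem poissonIntegral_eq (u : ℂ → E) (w : ℂ) :
    poissonIntegral u w = (2 * π)⁻¹ •
      ∫ t in (0 : ℝ)..2 * π, poissonKernel 0 w (circleMap 0 1 t) • u (circleMap 0 1 t) := rfl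

theorem poissonIntegral_const [CompleteSpace E] {w : ℂ} (hw : w ∈ disk) (c : E) :
    poissonIntegral (fun _ => c) w = c := by
  have h := InnerProductSpace.HarmonicOnNhd.circleAverage_poissonKernel_smul
    (f := fun _ => (1 : ℝ)) (c := 0) (w := w) (R := 1)
    (fun x _ => InnerProductSpace.harmonicAt_const (1 : ℝ)) hw
  have h' : (2 * π)⁻¹ * ∫ t in (0 : ℝ)..2 * π, poissonKernel 0 w (circleMap 0 1 t) = 1 := by
    refine Eq.trans ?_ h
    rw [circleAverage_def]
    simp
  rw [poissonIntegral_eq, intervalIntegral.integral_smul_const, ← mul_smul, h', one_smul]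

theorem intervalIntegrable_poissonKernel_smul {w : ℂ} (hw : w ∈ disk) {u : ℂ → E}
    (hu : CircleIntegrable u 0 1) :
    IntervalIntegrable (fun t => poissonKernel 0 w (circleMap 0 1 t) • u (circleMap 0 1 t))
      volume 0 (2 * π) :=
  IntervalIntegrable.continuousOn_smul hu (continuous_poissonKernel_circleMap hw).continuousOn

theorem poissonIntegral_sub {w : ℂ} (hw : w ∈ disk) {u v : ℂ → E}
    (hu : CircleIntegrable u 0 1) (hv : CircleIntegrable v 0 1) :
    poissonIntegral (u - v) w = poissonIntegral u w - poissonIntegral v w := by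
  simp only [poissonIntegral_eq, Pi.sub_apply, smul_sub]
  rw [intervalIntegral.integral_sub (intervalIntegrable_poissonKernel_smul hw hu)
    (intervalIntegrable_poissonKernel_smul hw hv), smul_sub]

theorem poissonIntegral_add {w : ℂ} (hw : w ∈ disk) {u v : ℂ → E}
    (hu : CircleIntegrable u 0 1) (hv : CircleIntegrable v 0 1) :
    poissonIntegral (u + v) w = poissonIntegral u w + poissonIntegral v w := by
  simp only [poissonIntegral_eq, Pi.add_apply, smul_add]
  rw [intervalIntegral.integral_add (intervalIntegrable_poissonKernel_smul hw hu)
    (intervalIntegrable_poissonKernel_smul hw hv), smul_add]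

theorem poissonIntegral_mono {w : ℂ} (hw : w ∈ disk) {u v : ℂ → ℝ}
    (hu : CircleIntegrable u 0 1) (hv : CircleIntegrable v 0 1)
    (huv : ∀ᵐ t : ℝ, u (circleMap 0 1 t) ≤ v (circleMap 0 1 t)) :
    poissonIntegral u w ≤ poissonIntegral v w := by
  simp only [poissonIntegral_eq, smul_eq_mul]
  refine mul_le_mul_of_nonneg_left ?_ (by positivity)
  refine intervalIntegral.integral_mono_ae two_pi_pos.le
    (intervalIntegrable_poissonKernel_smul hw hu) (intervalIntegrable_poissonKernel_smul hw hv) ?_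
  filter_upwards [huv] with t ht
  exact mul_le_mul_of_nonneg_left ht (poissonKernel_circleMap_pos hw t).le

theorem norm_poissonIntegral_le {w : ℂ} (hw : w ∈ disk) {u : ℂ → E} {M : ℝ}
    (hM : ∀ᵐ t : ℝ, ‖u (circleMap 0 1 t)‖ ≤ M) : ‖poissonIntegral u w‖ ≤ M := by
  rw [← poissonIntegral_const hw M, poissonIntegral_eq, poissonIntegral_eq, norm_smul,
    Real.norm_of_nonneg (by positivity), smul_eq_mul]
  refine mul_le_mul_of_nonneg_left ?_ (by positivity)
  refine intervalIntegral.norm_integral_le_of_norm_le two_pi_pos.le ?_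
    (intervalIntegrable_poissonKernel_smul hw (circleIntegrable_const M 0 1))
  filter_upwards [hM] with t ht _
  rw [norm_smul, Real.norm_of_nonneg (poissonKernel_circleMap_pos hw t).le]
  exact mul_le_mul_of_nonneg_left ht (poissonKernel_circleMap_pos hw t).le

/-! ### Radial limits of Poisson integrals -/

theorem norm_circleMap_sub_circleMap_sq (r t x : ℝ) :
    ‖circleMap 0 1 (t + x) - circleMap 0 r t‖ ^ 2 = (1 - r) ^ 2 + 2 * r * (1 - cos x) := by
  have h : circleMap 0 1 (t + x) - circleMap 0 r t =
      Complex.exp (t * Complex.I) * (Complex.exp (x * Complex.I) - r) := by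
    simp only [circleMap_zero, Complex.ofReal_add, add_mul, Complex.exp_add, Complex.ofReal_one]
    ring
  rw [h, norm_mul, Complex.norm_exp_ofReal_mul_I, one_mul, Complex.sq_norm, Complex.normSq_apply]
  simp only [Complex.sub_re, Complex.sub_im, Complex.exp_ofReal_mul_I_re,
    Complex.exp_ofReal_mul_I_im, Complex.ofReal_re, Complex.ofReal_im]
  nlinarith [sin_sq_add_cos_sq x]

theorem poissonKernel_circleMap_circleMap (r t x : ℝ) :
    poissonKernel 0 (circleMap 0 r t) (circleMap 0 1 (t + x)) =
      (1 - r ^ 2) / ((1 - r) ^ 2 + 2 * r * (1 - cos x)) := by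
  rw [poissonKernel_circleMap, norm_circleMap_sub_circleMap_sq, norm_circleMap_zero, sq_abs]

theorem integral_circleMap_add (f : ℂ → E) (t : ℝ) :
    ∫ x in -π..π, f (circleMap 0 1 (t + x)) = ∫ x in (0 : ℝ)..2 * π, f (circleMap 0 1 x) := by
  rw [intervalIntegral.integral_comp_add_left (fun x => f (circleMap 0 1 x))]
  have hp : (fun x => f (circleMap 0 1 x)).Periodic (2 * π) :=
    fun x => by simp [periodic_circleMap 0 1 x]
  have := hp.intervalIntegral_add_eq (t + -π) 0
  rw [zero_add] at this
  rw [← this]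
  congr 1
  ring

theorem locallyIntegrable_comp_circleMap {V : Type*} [NormedAddCommGroup V] {u : ℂ → V}
    (hu : CircleIntegrable u 0 1) :
    LocallyIntegrable (fun t => u (circleMap 0 1 t)) := by
  have hp : (fun x => u (circleMap 0 1 x)).Periodic (2 * π) :=
    fun x => by simp [periodic_circleMap 0 1 x]
  rw [locallyIntegrable_iff]
  intro k hk
  obtain ⟨a, ha⟩ := hk.isBounded.subset_closedBall 0
  rw [Real.closedBall_eq_Icc] at ha
  refine IntegrableOn.mono_set ?_ ha
  have h := hp.intervalIntegrable (t := 0) two_pi_pos.ne'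
    (by simpa [CircleIntegrable] using hu) (0 - a) (0 + a)
  rcases le_or_gt (0 - a) (0 + a) with h1 | h1
  · exact (intervalIntegrable_iff_integrableOn_Icc_of_le h1).1 h
  · rw [Icc_eq_empty_of_lt h1]
    exact integrableOn_empty

/-- **Fatou's theorem**: the Poisson integral of an integrable function has radial limits equal to
that function almost everywhere, namely at every Lebesgue point. -/
theorem ae_tendsto_poissonIntegral [CompleteSpace E] {u : ℂ → E} (hu : CircleIntegrable u 0 1) :
    ∀ᵐ t : ℝ, Tendsto (fun r : ℝ => poissonIntegral u (circleMap 0 r t)) (𝓝[<] 1)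
      (𝓝 (u (circleMap 0 1 t))) := by
  set g : ℝ → E := fun t => u (circleMap 0 1 t) with hg
  have hgl : LocallyIntegrable g := locallyIntegrable_comp_circleMap hu
  filter_upwards [(Besicovitch.vitaliFamily (volume : Measure ℝ)).ae_tendsto_lintegral_enorm_sub_div
    hgl] with t ht
  have ht' := ht.comp (Besicovitch.tendsto_filterAt volume t)
  set h : ℝ → ENNReal := fun x => ‖g (t + x) - g t‖ₑ with hh
  have hgt : LocallyIntegrable fun x => g x - g t := hgl.sub (locallyIntegrable_const _)
  have hmeas : AEMeasurable h volume :=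
    (hgt.aestronglyMeasurable.comp_measurePreserving (measurePreserving_add_left volume t)).enorm
  have hshift : ∀ s : Set ℝ, ∫⁻ x in (fun x => t + x) ⁻¹' s, h x = ∫⁻ y in s, ‖g y - g t‖ₑ :=
    fun s => (measurePreserving_add_left volume t).setLIntegral_comp_preimage_emb
      (measurableEmbedding_addLeft t) (fun y => ‖g y - g t‖ₑ) s
  have hball : ∀ ρ : ℝ, (fun x => t + x) ⁻¹' closedBall t ρ = closedBall 0 ρ := by
    intro ρ; ext x; simp
  set H : ENNReal := ∫⁻ x in Ioo (-π) π, h x with hH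
  have hHfin : H ≠ ⊤ := by
    have h1 : Ioo (-π) π ⊆ (fun x => t + x) ⁻¹' closedBall t π := by
      rw [hball, Real.closedBall_eq_Icc]
      intro x hx
      exact ⟨by linarith [hx.1], by linarith [hx.2]⟩
    refine ((lintegral_mono_set h1).trans_lt ?_).ne
    rw [hshift]
    exact (hgt.integrableOn_isCompact (isCompact_closedBall t π)).2
  set K : ℝ → ℝ → ℝ := fun r x => (1 - r ^ 2) / ((1 - r) ^ 2 + 2 * r * (1 - cos x)) with hK
  have hmain : ∀ r ∈ Ioo (0 : ℝ) 1, ∀ δ ∈ Ioo 0 π, ∀ ε : ENNReal,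
      (∀ ρ, 0 < ρ → ρ ≤ δ →
        ∫⁻ x in closedBall 0 ρ, h x ≤ ε * volume (closedBall (0 : ℝ) ρ)) →
      ‖poissonIntegral u (circleMap 0 r t) - g t‖ₑ ≤
        ε * ENNReal.ofReal (2 * π) + ENNReal.ofReal (K r δ) * H := by
    intro r hr δ hδ ε hε
    have hw : circleMap 0 r t ∈ disk := circleMap_mem_disk hr.1.le hr.2 t
    have hden : ∀ x, 0 < (1 - r) ^ 2 + 2 * r * (1 - cos x) := fun x => by
      have h1 : 0 < 1 - r := by linarith [hr.2]
      have h2 : 0 ≤ 2 * r * (1 - cos x) :=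
        mul_nonneg (by linarith [hr.1]) (by linarith [cos_le_one x])
      positivity
    have hnum : 0 < 1 - r ^ 2 := by nlinarith [hr.1, hr.2]
    have hK0 : ∀ x, 0 ≤ K r x := fun x => (div_pos hnum (hden x)).le
    have hKc : Continuous (K r) :=
      continuous_const.div (by fun_prop) fun x => (hden x).ne'
    have hKanti : ∀ x ∈ Ioo (-π) π, ∀ y ∈ Ioo (-π) π, |x| ≤ |y| → K r y ≤ K r x := by
      intro x hx y hy hxy
      have hcos : cos y ≤ cos x := by
        rw [← cos_abs x, ← cos_abs y]
        exact cos_le_cos_of_nonneg_of_le_pi (abs_nonneg x) (abs_lt.2 hy).le hxy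
      refine div_le_div_of_nonneg_left hnum.le (hden x) ?_
      have := mul_le_mul_of_nonneg_left hcos (by linarith [hr.1] : (0 : ℝ) ≤ 2 * r)
      linarith
    have hbell := lintegral_mul_le_of_antitone_abs hδ.1 hδ.2 hK0 hKc.measurable hKanti
      (hmeas.mono_measure Measure.restrict_le_self) hε
    have hKint : ∫⁻ x in Ioo (-π) π, ENNReal.ofReal (K r x) = ENNReal.ofReal (2 * π) := by
      rw [← ofReal_integral_eq_lintegral_ofReal
        (hKc.locallyIntegrable.integrableOn_isCompact isCompact_Icc |>.mono_set Ioo_subset_Icc_self)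
        (Eventually.of_forall hK0), ← integral_Ioc_eq_integral_Ioo,
        ← intervalIntegral.integral_of_le (by linarith [pi_pos])]
      have h1 : ∀ x, K r x = poissonKernel 0 (circleMap 0 r t) (circleMap 0 1 (t + x)) :=
        fun x => (poissonKernel_circleMap_circleMap r t x).symm
      simp_rw [h1]
      rw [integral_circleMap_add]
      have h2 := poissonIntegral_const hw (1 : ℝ)
      rw [poissonIntegral_eq] at h2
      simp only [smul_eq_mul, mul_one] at h2
      congr 1
      field_simp at h2
      exact h2
    have hrep : poissonIntegral u (circleMap 0 r t) - g t =
        (2 * π)⁻¹ • ∫ x in -π..π, K r x • (g (t + x) - g t) := by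
      have h0 : poissonIntegral u (circleMap 0 r t) - g t =
          poissonIntegral (u - fun _ => g t) (circleMap 0 r t) := by
        rw [poissonIntegral_sub hw hu (circleIntegrable_const _ _ _), poissonIntegral_const hw]
      rw [h0, poissonIntegral_eq,
        ← integral_circleMap_add (fun ζ => poissonKernel 0 (circleMap 0 r t) ζ •
          ((u - fun _ => g t : ℂ → E) ζ)) t]
      simp_rw [poissonKernel_circleMap_circleMap]
      rfl
    calc ‖poissonIntegral u (circleMap 0 r t) - g t‖ₑ
        ≤ ‖∫ x in -π..π, K r x • (g (t + x) - g t)‖ₑ := by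
          rw [hrep, enorm_smul]
          refine mul_le_of_le_one_left zero_le ?_
          rw [Real.enorm_of_nonneg (by positivity), ENNReal.ofReal_le_one]
          exact inv_le_one_of_one_le₀ (by linarith [pi_gt_three])
      _ ≤ ∫⁻ x in Ioo (-π) π, ENNReal.ofReal (K r x) * h x := by
          rw [intervalIntegral.integral_of_le (by linarith [pi_pos]), integral_Ioc_eq_integral_Ioo]
          refine (enorm_integral_le_lintegral_enorm _).trans_eq ?_
          refine lintegral_congr fun x => ?_
          rw [enorm_smul, Real.enorm_of_nonneg (hK0 x)]
      _ ≤ _ := by rw [hKint] at hbell; exact hbell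
  rw [tendsto_iff_edist_tendsto_0, ENNReal.tendsto_nhds_zero]
  intro ε hε
  have h2π : ENNReal.ofReal (2 * π) ≠ 0 := by simpa using pi_pos
  set ε₁ : ENNReal := ε / 2 / ENNReal.ofReal (2 * π) with hε₁
  have hε₁0 : 0 < ε₁ := ENNReal.div_pos (ENNReal.half_pos hε.ne').ne' ENNReal.ofReal_ne_top
  have hev := (ENNReal.tendsto_nhds_zero.1 ht') ε₁ hε₁0
  rw [eventually_nhdsWithin_iff, Metric.eventually_nhds_iff] at hev
  obtain ⟨δ₀, hδ₀, hδ₀'⟩ := hev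
  set δ : ℝ := min (δ₀ / 2) 1 with hδ
  have hδpos : 0 < δ := lt_min (by positivity) one_pos
  have hδπ : δ < π := (min_le_right _ _).trans_lt (by linarith [pi_gt_three])
  have hδlt : δ < δ₀ := (min_le_left _ _).trans_lt (by linarith)
  have hleb : ∀ ρ, 0 < ρ → ρ ≤ δ →
      ∫⁻ x in closedBall 0 ρ, h x ≤ ε₁ * volume (closedBall (0 : ℝ) ρ) := by
    intro ρ hρ hρδ
    have h1 := @hδ₀' ρ (by rw [Real.dist_eq, sub_zero, abs_of_pos hρ]; linarith) hρ
    simp only [Function.comp_apply] at h1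
    rw [ENNReal.div_le_iff (measure_closedBall_pos _ _ hρ).ne' measure_closedBall_lt_top.ne] at h1
    rw [← hball, hshift]
    refine h1.trans_eq ?_
    rw [hball, Real.volume_closedBall, Real.volume_closedBall]
  have hcosδ : cos δ < 1 := by
    rw [← cos_zero]
    exact cos_lt_cos_of_nonneg_of_le_pi le_rfl hδπ.le hδpos
  have hKlim : Tendsto (fun r => ENNReal.ofReal (K r δ) * H) (𝓝[<] 1) (𝓝 0) := by
    have h1 : Tendsto (fun r => K r δ) (𝓝[<] 1) (𝓝 (K 1 δ)) := by
      have : ContinuousAt (fun r => K r δ) 1 := by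
        refine ContinuousAt.div (by fun_prop) (by fun_prop) ?_
        norm_num
        linarith
      exact this.tendsto.mono_left nhdsWithin_le_nhds
    have h2 : K 1 δ = 0 := by simp [hK]
    rw [h2] at h1
    have h3 := ENNReal.Tendsto.mul_const (b := H) (ENNReal.tendsto_ofReal h1) (Or.inr hHfin)
    simpa using h3
  filter_upwards [ENNReal.tendsto_nhds_zero.1 hKlim (ε / 2) (ENNReal.half_pos hε.ne'),
    Ioo_mem_nhdsLT (show (0 : ℝ) < 1 by norm_num)] with r hr1 hr2
  rw [edist_eq_enorm_sub]
  calc _ ≤ ε₁ * ENNReal.ofReal (2 * π) + ENNReal.ofReal (K r δ) * H :=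
        hmain r hr2 δ ⟨hδpos, hδπ⟩ ε₁ hleb
    _ ≤ ε / 2 + ε / 2 := by
        rw [hε₁, ENNReal.div_mul_cancel h2π ENNReal.ofReal_ne_top]
        gcongr
    _ = ε := ENNReal.add_halves ε

end PoissonIntegral

/-! ### Boundary values of bounded holomorphic functions -/

/-- Every function of the angle on one period comes from a function on the circle. -/
theorem exists_eqOn_circleMap (U : ℝ → ℂ) :
    ∃ u : ℂ → ℂ, ∀ t ∈ Ioc 0 (2 * π), u (circleMap 0 1 t) = U t := by
  refine ⟨fun ζ => U (toIocMod two_pi_pos 0 ζ.arg), fun t ht => ?_⟩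
  have h1 : (circleMap 0 1 t).arg = toIocMod two_pi_pos (-π) t := by
    rw [circleMap_zero, Complex.ofReal_one, one_mul, Complex.arg_exp_mul_I]
  simp only [h1]
  congr 1
  rw [toIocMod_toIocMod]
  rw [toIocMod_eq_self]
  simpa using ht

theorem poissonIntegral_dilation {f : ℂ → ℂ} (hf : DifferentiableOn ℂ f disk) {r : ℝ}
    (hr0 : 0 ≤ r) (hr1 : r < 1) {w : ℂ} (hw : w ∈ disk) :
    poissonIntegral (fun ζ => f (r * ζ)) w = f (r * w) := by
  have hmaps : MapsTo (fun ζ : ℂ => (r : ℂ) * ζ) (closedBall 0 1) disk := by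
    intro ζ hζ
    rw [mem_closedBall_zero_iff] at hζ
    rw [mem_disk, norm_mul, Complex.norm_real, Real.norm_of_nonneg hr0]
    nlinarith [norm_nonneg ζ]
  have hd : DiffContOnCl ℂ (fun ζ => f (r * ζ)) (ball 0 1) := by
    refine ⟨hf.comp (by fun_prop) (hmaps.mono_left ball_subset_closedBall), ?_⟩
    rw [closure_ball _ one_ne_zero]
    exact hf.continuousOn.comp (by fun_prop) hmaps
  exact hd.circleAverage_poissonKernel_smul hw

theorem ofReal_mul_circleMap (r t : ℝ) : (r : ℂ) * circleMap 0 1 t = circleMap 0 r t := by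
  simp [circleMap_zero]

/-- A bounded holomorphic function is the Poisson integral of an integrable function on the
circle. The boundary function is a weak limit in `L²` of dilations of `f`. -/
theorem IsHInfty.exists_poissonIntegral_eq {f : ℂ → ℂ} (hf : IsHInfty f) :
    ∃ u : ℂ → ℂ, CircleIntegrable u 0 1 ∧ ∀ w ∈ disk, f w = poissonIntegral u w := by
  obtain ⟨hd, C, hC⟩ := hf
  set μ : Measure ℝ := volume.restrict (Ioc 0 (2 * π)) with hμ
  set ρ : ℕ → ℝ := fun n => 1 - 1 / ((n : ℝ) + 1) with hρ
  have hρ0 : ∀ n, 0 ≤ ρ n := fun n => by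
    have : 1 / ((n : ℝ) + 1) ≤ 1 := by
      rw [div_le_one (by positivity)]
      linarith [Nat.cast_nonneg (α := ℝ) n]
    simp only [hρ]; linarith
  have hρ1 : ∀ n, ρ n < 1 := fun n => by
    have : 0 < 1 / ((n : ℝ) + 1) := by positivity
    simp only [hρ]; linarith
  have hρlim : Tendsto ρ atTop (𝓝 1) := by
    simpa [hρ] using (tendsto_one_div_add_atTop_nhds_zero_nat (𝕜 := ℝ)).const_sub 1
  set F : ℕ → ℝ → ℂ := fun n t => f (circleMap 0 (ρ n) t) with hF
  have hFc : ∀ n, Continuous (F n) := fun n =>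
    hd.continuousOn.comp_continuous (continuous_circleMap _ _)
      fun t => circleMap_mem_disk (hρ0 n) (hρ1 n) t
  have hFC : ∀ n t, ‖F n t‖ ≤ C := fun n t => hC _ (circleMap_mem_disk (hρ0 n) (hρ1 n) t)
  have hFL : ∀ n, MemLp (F n) 2 μ := fun n =>
    MemLp.of_bound (hFc n).aestronglyMeasurable C (Eventually.of_forall (hFC n))
  set Λ : ℕ → StrongDual ℂ (Lp ℂ 2 μ) := fun n => innerSL ℂ (hFL n).toLp with hΛ
  obtain ⟨R, hR⟩ : ∃ R, ∀ n, ‖Λ n‖ ≤ R := by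
    refine ⟨((μ univ).toNNReal : ℝ) ^ ((2 : ENNReal).toReal)⁻¹ * C, fun n => ?_⟩
    rw [hΛ, innerSL_apply_norm]
    refine Lp.norm_le_of_ae_bound ((norm_nonneg _).trans (hFC 0 0)) ?_
    filter_upwards [(hFL n).coeFn_toLp] with t ht
    rw [ht]
    exact hFC n t
  -- Banach–Alaoglu: the functionals `Λ n` converge weakly along an ultrafilter
  have hcpt := WeakDual.isCompact_closedBall (𝕜 := ℂ) (0 : StrongDual ℂ (Lp ℂ 2 μ)) R
  obtain ⟨Λ₀, -, hΛ₀⟩ := hcpt.ultrafilter_le_nhds'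
    ((hyperfilter ℕ).map fun n => StrongDual.toWeakDual (Λ n)) (by
      refine Ultrafilter.mem_map.2 (univ_mem' fun n => ?_)
      simpa using hR n)
  have hΛlim : Tendsto (fun n => StrongDual.toWeakDual (Λ n)) (hyperfilter ℕ : Filter ℕ) (𝓝 Λ₀) :=
    hΛ₀
  have heval : ∀ g : Lp ℂ 2 μ, Tendsto (fun n => Λ n g) (hyperfilter ℕ : Filter ℕ) (𝓝 (Λ₀ g)) :=
    fun g => ((WeakDual.eval_continuous g).tendsto Λ₀).comp hΛlim
  set U : Lp ℂ 2 μ := (InnerProductSpace.toDual ℂ (Lp ℂ 2 μ)).symm (WeakDual.toStrongDual Λ₀)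
    with hU
  have hUg : ∀ g : Lp ℂ 2 μ, inner ℂ U g = Λ₀ g := fun g => by
    rw [hU, InnerProductSpace.toDual_symm_apply]
    rfl
  obtain ⟨u, hu⟩ := exists_eqOn_circleMap U
  have huU : (fun t => u (circleMap 0 1 t)) =ᵐ[μ] U :=
    (ae_restrict_iff' measurableSet_Ioc).2 (Eventually.of_forall hu)
  have hint : Integrable (fun t => u (circleMap 0 1 t)) μ :=
    (integrable_congr huU).2 ((Lp.memLp U).integrable one_le_two)
  refine ⟨u, (intervalIntegrable_iff_integrableOn_Ioc_of_le two_pi_pos.le).2 hint,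
    fun w hw => ?_⟩
  set p : ℝ → ℂ := fun t => (poissonKernel 0 w (circleMap 0 1 t) : ℂ) with hp
  obtain ⟨Cp, -, hCp⟩ := exists_poissonKernel_le hw
  have hpL : MemLp p 2 μ := by
    refine MemLp.of_bound
      (Complex.continuous_ofReal.comp
        (continuous_poissonKernel_circleMap hw)).aestronglyMeasurable Cp
      (Eventually.of_forall fun t => ?_)
    rw [hp, Complex.norm_real, Real.norm_of_nonneg (poissonKernel_circleMap_pos hw t).le]
    exact hCp t
  -- pairing with the (real) Poisson kernel recovers the Poisson integral
  have hpair : ∀ (V : Lp ℂ 2 μ) (v : ℂ → ℂ), (fun t => v (circleMap 0 1 t)) =ᵐ[μ] V →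
      inner ℂ hpL.toLp V = 2 * π * poissonIntegral v w := by
    intro V v hv
    rw [L2.inner_def, poissonIntegral_eq, intervalIntegral.integral_of_le two_pi_pos.le, ← hμ]
    rw [Complex.real_smul]
    push_cast
    rw [mul_inv_cancel_left₀ (by simp)]
    refine integral_congr_ae ?_
    filter_upwards [hv, hpL.coeFn_toLp] with t h1 h2
    rw [← h1, h2, RCLike.inner_apply, hp, Complex.conj_ofReal, Complex.real_smul, mul_comm]
  have hlim1 := heval hpL.toLp
  rw [← hUg, ← inner_conj_symm, hpair U u huU] at hlim1
  have hΛn : ∀ n, Λ n hpL.toLp = (starRingEnd ℂ) (2 * π * f (ρ n * w)) := by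
    intro n
    rw [hΛ, innerSL_apply_apply, ← inner_conj_symm,
      hpair _ (fun ζ => f (ρ n * ζ)) ?_, poissonIntegral_dilation hd (hρ0 n) (hρ1 n) hw]
    filter_upwards [(hFL n).coeFn_toLp] with t ht
    rw [ht, ofReal_mul_circleMap]
  simp_rw [hΛn] at hlim1
  have hlim2 : Tendsto (fun n => (starRingEnd ℂ) (2 * π * f (ρ n * w))) (hyperfilter ℕ : Filter ℕ)
      (𝓝 ((starRingEnd ℂ) (2 * π * f w))) := by
    have h1 : Tendsto (fun n => (ρ n : ℂ) * w) atTop (𝓝 w) := by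
      simpa using ((Complex.continuous_ofReal.tendsto 1).comp hρlim).mul_const w
    have h2 := ((hd.continuousOn.continuousAt (isOpen_disk.mem_nhds hw)).tendsto.comp h1)
    have h3 := (Complex.continuous_conj.tendsto _).comp (h2.const_mul (2 * π : ℂ))
    exact h3.mono_left Nat.hyperfilter_le_atTop
  have := (starRingEnd ℂ).injective (tendsto_nhds_unique hlim2 hlim1)
  have hπ : (2 * π : ℂ) ≠ 0 := by simp
  exact mul_left_cancel₀ hπ this

/-- A maximum principle: a bound for the radial limits of a bounded holomorphic function at almost
every boundary point is a bound on the disk. -/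
theorem IsHInfty.norm_le_of_radial {f : ℂ → ℂ} (hf : IsHInfty f) {M : ℝ}
    (hM : ∀ᵐ t : ℝ, ∃ L ≤ M, Tendsto (fun r : ℝ => ‖f (circleMap 0 r t)‖) (𝓝[<] 1) (𝓝 L))
    {w : ℂ} (hw : w ∈ disk) : ‖f w‖ ≤ M := by
  obtain ⟨u, hu, hfu⟩ := hf.exists_poissonIntegral_eq
  rw [hfu w hw]
  refine norm_poissonIntegral_le hw ?_
  filter_upwards [hM, ae_tendsto_poissonIntegral hu] with t ⟨L, hL, hLt⟩ ht
  have h1 : Tendsto (fun r : ℝ => ‖f (circleMap 0 r t)‖) (𝓝[<] 1) (𝓝 ‖u (circleMap 0 1 t)‖) := by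
    refine ht.norm.congr' ?_
    filter_upwards [Ioo_mem_nhdsLT (show (0 : ℝ) < 1 by norm_num)] with r hr
    rw [hfu _ (circleMap_mem_disk hr.1.le hr.2 t)]
  rwa [tendsto_nhds_unique h1 hLt]

theorem IsHInfty.exists_ae_tendsto_radial {f : ℂ → ℂ} (hf : IsHInfty f) :
    ∃ u : ℂ → ℂ, CircleIntegrable u 0 1 ∧
      ∀ᵐ t : ℝ, Tendsto (fun r : ℝ => f (circleMap 0 r t)) (𝓝[<] 1) (𝓝 (u (circleMap 0 1 t))) := by
  obtain ⟨u, hu, hfu⟩ := hf.exists_poissonIntegral_eq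
  refine ⟨u, hu, ?_⟩
  filter_upwards [ae_tendsto_poissonIntegral hu] with t ht
  refine ht.congr' ?_
  filter_upwards [Ioo_mem_nhdsLT (show (0 : ℝ) < 1 by norm_num)] with r hr
  rw [hfu _ (circleMap_mem_disk hr.1.le hr.2 t)]

/-! ### Outer functions and the inner-outer factorization -/

/-- The outer function whose modulus has boundary values `exp ω`. -/
noncomputable def outerFunction (ω : ℂ → ℝ) (w : ℂ) : ℂ :=
  Complex.exp (circleAverage (fun ζ => herglotzRieszKernel 0 w ζ • (ω ζ : ℂ)) 0 1)

theorem differentiableOn_outerFunction {ω : ℂ → ℝ} (hω : CircleIntegrable ω 0 1) :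
    DifferentiableOn ℂ (outerFunction ω) disk := by
  have h1 : CircleIntegrable (fun ζ => (ω ζ : ℂ)) 0 1 := by
    simp only [CircleIntegrable, intervalIntegrable_iff] at hω ⊢
    exact Complex.ofRealCLM.integrable_comp hω
  exact (differentiableOn_circleAverage_herglotzRieszKernel_smul h1).cexp

theorem log_norm_outerFunction {ω : ℂ → ℝ} (hω : CircleIntegrable ω 0 1) {w : ℂ} (hw : w ∈ disk) :
    log ‖outerFunction ω w‖ = poissonIntegral ω w := by
  rw [outerFunction, Complex.norm_exp, log_exp, re_circleAverage_herglotzRieszKernel_smul hω hw,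
    ← poissonKernel_eq_re_herglotzRieszKernel]
  rfl

theorem outerFunction_ne_zero (ω : ℂ → ℝ) (w : ℂ) : outerFunction ω w ≠ 0 := Complex.exp_ne_zero _

theorem norm_outerFunction {ω : ℂ → ℝ} (hω : CircleIntegrable ω 0 1) {w : ℂ} (hw : w ∈ disk) :
    ‖outerFunction ω w‖ = exp (poissonIntegral ω w) := by
  rw [← log_norm_outerFunction hω hw, exp_log (norm_pos_iff.2 (outerFunction_ne_zero ω w))]

/-- `G` is outer, with boundary values `ω` of `log |G|`. -/
def IsOuterWith (ω : ℂ → ℝ) (G : ℂ → ℂ) : Prop :=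
  DifferentiableOn ℂ G disk ∧ (∀ w ∈ disk, G w ≠ 0) ∧ CircleIntegrable ω 0 1 ∧
    ∀ w ∈ disk, log ‖G w‖ = poissonIntegral ω w

theorem isOuter_iff {G : ℂ → ℂ} : IsOuter G ↔ ∃ ω, IsOuterWith ω G :=
  ⟨fun ⟨h1, h2, ω, h3, h4⟩ => ⟨ω, h1, h2, h3, h4⟩,
    fun ⟨ω, h1, h2, h3, h4⟩ => ⟨h1, h2, ω, h3, h4⟩⟩

theorem isOuterWith_outerFunction {ω : ℂ → ℝ} (hω : CircleIntegrable ω 0 1) :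
    IsOuterWith ω (outerFunction ω) :=
  ⟨differentiableOn_outerFunction hω, fun w _ => outerFunction_ne_zero ω w, hω,
    fun _ hw => log_norm_outerFunction hω hw⟩

theorem IsOuterWith.mul {ω₁ ω₂ : ℂ → ℝ} {G₁ G₂ : ℂ → ℂ} (h₁ : IsOuterWith ω₁ G₁)
    (h₂ : IsOuterWith ω₂ G₂) : IsOuterWith (ω₁ + ω₂) (fun w => G₁ w * G₂ w) := by
  obtain ⟨a1, a2, a3, a4⟩ := h₁
  obtain ⟨b1, b2, b3, b4⟩ := h₂
  refine ⟨a1.mul b1, fun w hw => mul_ne_zero (a2 w hw) (b2 w hw), a3.add b3, fun w hw => ?_⟩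
  rw [norm_mul, log_mul (norm_ne_zero_iff.2 (a2 w hw)) (norm_ne_zero_iff.2 (b2 w hw)),
    a4 w hw, b4 w hw, poissonIntegral_add hw a3 b3]

theorem IsOuterWith.div {ω₁ ω₂ : ℂ → ℝ} {G₁ G₂ : ℂ → ℂ} (h₁ : IsOuterWith ω₁ G₁)
    (h₂ : IsOuterWith ω₂ G₂) : IsOuterWith (ω₁ - ω₂) (fun w => G₁ w / G₂ w) := by
  obtain ⟨a1, a2, a3, a4⟩ := h₁
  obtain ⟨b1, b2, b3, b4⟩ := h₂
  refine ⟨a1.div b1 b2, fun w hw => div_ne_zero (a2 w hw) (b2 w hw), a3.sub b3, fun w hw => ?_⟩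
  rw [norm_div, log_div (norm_ne_zero_iff.2 (a2 w hw)) (norm_ne_zero_iff.2 (b2 w hw)),
    a4 w hw, b4 w hw, poissonIntegral_sub hw a3 b3]

theorem IsOuterWith.ae_tendsto_norm {ω : ℂ → ℝ} {G : ℂ → ℂ} (h : IsOuterWith ω G) :
    ∀ᵐ t : ℝ, Tendsto (fun r : ℝ => ‖G (circleMap 0 r t)‖) (𝓝[<] 1)
      (𝓝 (exp (ω (circleMap 0 1 t)))) := by
  obtain ⟨-, h2, h3, h4⟩ := h
  filter_upwards [ae_tendsto_poissonIntegral h3] with t ht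
  refine ((continuous_exp.tendsto _).comp ht).congr' ?_
  filter_upwards [Ioo_mem_nhdsLT (show (0 : ℝ) < 1 by norm_num)] with r hr
  have hw := circleMap_mem_disk hr.1.le hr.2 t
  rw [Function.comp_apply, ← h4 _ hw, exp_log (norm_pos_iff.2 (h2 _ hw))]

theorem ae_restrict_circle {p : ℝ → Prop} (h : ∀ᵐ t : ℝ, p t) :
    ∀ᵐ t ∂(volume.restrict (Ioc 0 (2 * π))), p t := ae_restrict_of_ae h

theorem circleIntegrable_iff_integrable {E : Type*} [NormedAddCommGroup E] {u : ℂ → E} :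
    CircleIntegrable u 0 1 ↔
      Integrable (fun t => u (circleMap 0 1 t)) (volume.restrict (Ioc 0 (2 * π))) :=
  intervalIntegrable_iff_integrableOn_Ioc_of_le two_pi_pos.le

/-- A property of almost all angles of one period holds for almost all angles. -/
theorem ae_of_ae_restrict_circle {p : ℂ → Prop}
    (h : ∀ᵐ t ∂(volume.restrict (Ioc 0 (2 * π))), p (circleMap 0 1 t)) :
    ∀ᵐ t : ℝ, p (circleMap 0 1 t) := by
  rw [ae_restrict_iff' measurableSet_Ioc] at h
  -- translate the null set by the multiples of the period
  have h' : ∀ n : ℤ, ∀ᵐ t : ℝ, t + n * (2 * π) ∈ Ioc 0 (2 * π) →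
      p (circleMap 0 1 (t + n * (2 * π))) := fun n =>
    (measurePreserving_add_right volume ((n : ℝ) * (2 * π))).quasiMeasurePreserving.ae h
  filter_upwards [ae_all_iff.2 h'] with t ht
  obtain ⟨n, hn, -⟩ := existsUnique_add_zsmul_mem_Ioc two_pi_pos t 0
  have := ht n (by simpa using hn)
  rwa [(periodic_circleMap 0 1).int_mul n t] at this

/-- The outer function with boundary modulus `max |u| ε`, where `u` is the boundary function of `f`,
is a majorant of `f`. It is bounded below by `ε`, so the quotient is a bounded holomorphic function
and the maximum principle for radial limits applies. -/
theorem IsHInfty.log_norm_le_of_radial {f : ℂ → ℂ} (hf : IsHInfty f) {u : ℂ → ℂ}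
    (hu : CircleIntegrable u 0 1)
    (hfu : ∀ᵐ t : ℝ, Tendsto (fun r : ℝ => f (circleMap 0 r t)) (𝓝[<] 1)
      (𝓝 (u (circleMap 0 1 t))))
    {C : ℝ} (hC : ∀ᵐ t : ℝ, ‖u (circleMap 0 1 t)‖ ≤ C) {ε : ℝ} (hε : 0 < ε) (hεC : ε ≤ C) :
    CircleIntegrable (fun ζ => log (max ‖u ζ‖ ε)) 0 1 ∧ ∀ w ∈ disk, f w ≠ 0 →
      log ‖f w‖ ≤ poissonIntegral (fun ζ => log (max ‖u ζ‖ ε)) w := by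
  set ω : ℂ → ℝ := fun ζ => log (max ‖u ζ‖ ε) with hω
  have hum := (circleIntegrable_iff_integrable.1 hu).aestronglyMeasurable
  have hωlow : ∀ ζ, log ε ≤ ω ζ := fun ζ => log_le_log hε (le_max_right _ _)
  have hωint : CircleIntegrable ω 0 1 := by
    rw [circleIntegrable_iff_integrable]
    refine Integrable.of_bound (C := max |log ε| |log C|) ?_ ?_
    · exact (measurable_log.comp_aemeasurable
        (hum.norm.aemeasurable.max aemeasurable_const)).aestronglyMeasurable
    · filter_upwards [ae_restrict_circle hC] with t ht
      have h1 : ω (circleMap 0 1 t) ≤ log C :=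
        log_le_log (lt_max_of_lt_right hε) (max_le ht hεC)
      exact abs_le_max_abs_abs (hωlow _) h1
  refine ⟨hωint, fun w hw hfw => ?_⟩
  have hU := isOuterWith_outerFunction hωint
  have hUε : ∀ w ∈ disk, ε ≤ ‖outerFunction ω w‖ := by
    intro w hw
    rw [norm_outerFunction hωint hw, ← log_le_iff_le_exp hε, ← poissonIntegral_const hw (log ε)]
    exact poissonIntegral_mono hw (circleIntegrable_const _ _ _) hωint
      (Eventually.of_forall fun t => hωlow _)
  have hq : IsHInfty fun w => f w / outerFunction ω w := by
    obtain ⟨hd, A, hA⟩ := hf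
    refine ⟨hd.div hU.1 hU.2.1, A / ε, fun w hw => ?_⟩
    rw [norm_div]
    exact div_le_div₀ ((norm_nonneg _).trans (hA w hw)) (hA w hw) hε (hUε w hw)
  have hle : ‖f w / outerFunction ω w‖ ≤ 1 := by
    refine hq.norm_le_of_radial ?_ hw
    filter_upwards [hfu, hU.ae_tendsto_norm] with t h1 h2
    refine ⟨_, ?_, (h1.norm.div h2 (exp_ne_zero _)).congr fun r => (norm_div _ _).symm⟩
    rw [div_le_one (exp_pos _), hω, exp_log (lt_max_of_lt_right hε)]
    exact le_max_left _ _
  rw [← log_norm_outerFunction hωint hw]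
  refine log_le_log (norm_pos_iff.2 hfw) ?_
  rwa [norm_div, div_le_one (norm_pos_iff.2 (outerFunction_ne_zero ω w))] at hle

/-- The boundary function of a bounded holomorphic function that is not identically zero has an
integrable logarithm, and `log |f|` is at most the Poisson integral of that logarithm. The statement
`u ≠ 0` almost everywhere is separate because of the junk value `Real.log 0 = 0`. -/
theorem IsHInfty.log_integrable_of_radial {f : ℂ → ℂ} (hf : IsHInfty f) {u : ℂ → ℂ}
    (hu : CircleIntegrable u 0 1)
    (hfu : ∀ᵐ t : ℝ, Tendsto (fun r : ℝ => f (circleMap 0 r t)) (𝓝[<] 1)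
      (𝓝 (u (circleMap 0 1 t))))
    (hne : ∃ w ∈ disk, f w ≠ 0) :
    (∀ᵐ t : ℝ, u (circleMap 0 1 t) ≠ 0) ∧ CircleIntegrable (fun ζ => log ‖u ζ‖) 0 1 ∧
      ∀ w ∈ disk, f w ≠ 0 → log ‖f w‖ ≤ poissonIntegral (fun ζ => log ‖u ζ‖) w := by
  obtain ⟨C, hC1, hC⟩ : ∃ C : ℝ, 1 ≤ C ∧ ∀ᵐ t : ℝ, ‖u (circleMap 0 1 t)‖ ≤ C := by
    obtain ⟨A, hA⟩ := hf.2
    refine ⟨max A 1, le_max_right _ _, ?_⟩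
    filter_upwards [hfu] with t ht
    refine le_of_tendsto ht.norm ?_
    filter_upwards [Ioo_mem_nhdsLT (show (0 : ℝ) < 1 by norm_num)] with r hr
    exact (hA _ (circleMap_mem_disk hr.1.le hr.2 t)).trans (le_max_left _ _)
  set μ : Measure ℝ := volume.restrict (Ioc 0 (2 * π)) with hμ
  set ε : ℕ → ℝ := fun n => 1 / ((n : ℝ) + 1) with hε
  have hε0 : ∀ n, 0 < ε n := fun n => by simp only [hε]; positivity
  have hε1 : ∀ n, ε n ≤ 1 := fun n => by
    simp only [hε]
    rw [div_le_one (by positivity)]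
    linarith [Nat.cast_nonneg (α := ℝ) n]
  have hεlim : Tendsto ε atTop (𝓝 0) := tendsto_one_div_add_atTop_nhds_zero_nat
  set ω : ℕ → ℂ → ℝ := fun n ζ => log (max ‖u ζ‖ (ε n)) with hω
  have hmaj := fun n => hf.log_norm_le_of_radial hu hfu hC (hε0 n) ((hε1 n).trans hC1)
  have hωint : ∀ n, CircleIntegrable (ω n) 0 1 := fun n => (hmaj n).1
  have hωle : ∀ n w, w ∈ disk → f w ≠ 0 → log ‖f w‖ ≤ poissonIntegral (ω n) w :=
    fun n w => (hmaj n).2 w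
  have hωC : ∀ n, ∀ᵐ t : ℝ, ω n (circleMap 0 1 t) ≤ log C := fun n => by
    filter_upwards [hC] with t ht
    exact log_le_log (lt_max_of_lt_right (hε0 n)) (max_le ht ((hε1 n).trans hC1))
  -- the defects `log C - ω n` have bounded integrals
  set g : ℕ → ℝ → ℝ := fun n t => log C - ω n (circleMap 0 1 t) with hg
  have hgint : ∀ n, Integrable (g n) μ := fun n =>
    (integrable_const _).sub (circleIntegrable_iff_integrable.1 (hωint n))
  have hg0 : ∀ n, 0 ≤ᵐ[μ] g n := fun n => by
    filter_upwards [ae_restrict_circle (hωC n)] with t ht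
    simpa [hg] using ht
  obtain ⟨B, hB⟩ : ∃ B : ℝ, ∀ n, ∫ t, g n t ∂μ ≤ B := by
    obtain ⟨w, hw, hfw⟩ := hne
    obtain ⟨c, hc, hcP⟩ := exists_le_poissonKernel hw
    refine ⟨(log C - log ‖f w‖) * (2 * π) / c, fun n => ?_⟩
    rw [le_div_iff₀ hc, ← div_le_iff₀ two_pi_pos]
    have h1 : poissonIntegral ((fun _ => log C) - ω n) w ≤ log C - log ‖f w‖ := by
      rw [poissonIntegral_sub hw (circleIntegrable_const _ _ _) (hωint n), poissonIntegral_const hw]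
      linarith [hωle n w hw hfw]
    refine le_trans ?_ h1
    rw [poissonIntegral_eq, smul_eq_mul, div_eq_inv_mul,
      intervalIntegral.integral_of_le two_pi_pos.le, ← hμ, ← integral_mul_const]
    refine mul_le_mul_of_nonneg_left ?_ (by positivity)
    refine integral_mono_ae ((hgint n).mul_const c) ?_ ?_
    · exact (intervalIntegrable_iff_integrableOn_Ioc_of_le two_pi_pos.le).1
        (intervalIntegrable_poissonKernel_smul hw
          ((circleIntegrable_const (log C) 0 1).sub (hωint n)))
    · filter_upwards [hg0 n] with t ht
      rw [mul_comm]
      exact mul_le_mul_of_nonneg_right (hcP t) ht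
  have hB' : ∀ n, ∫⁻ t, ENNReal.ofReal (g n t) ∂μ ≤ ENNReal.ofReal B := fun n => by
    rw [← ofReal_integral_eq_lintegral_ofReal (hgint n) (hg0 n)]
    exact ENNReal.ofReal_le_ofReal (hB n)
  -- by Fatou's lemma the limit of the defects is integrable, so `u` cannot vanish on a set of
  -- positive measure
  have hfatou : ∫⁻ t, liminf (fun n => ENNReal.ofReal (g n t)) atTop ∂μ ≤ ENNReal.ofReal B := by
    refine (lintegral_liminf_le' fun n => (hgint n).aemeasurable.ennreal_ofReal).trans ?_
    exact (liminf_le_liminf (Eventually.of_forall hB')).trans_eq (liminf_const _)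
  have hliminf : AEMeasurable (fun t => liminf (fun n => ENNReal.ofReal (g n t)) atTop) μ := by
    have hm := fun n => (hgint n).aemeasurable.ennreal_ofReal
    refine ⟨fun t => liminf (fun n => (hm n).mk _ t) atTop,
      .liminf fun n => (hm n).measurable_mk, ?_⟩
    filter_upwards [ae_all_iff.2 fun n => (hm n).ae_eq_mk] with t ht
    exact congrArg (liminf · atTop) (funext ht)
  have hfin : ∀ᵐ t ∂μ, liminf (fun n => ENNReal.ofReal (g n t)) atTop < ⊤ :=
    ae_lt_top' hliminf (hfatou.trans_lt ENNReal.ofReal_lt_top).ne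
  have hune : ∀ᵐ t ∂μ, u (circleMap 0 1 t) ≠ 0 := by
    filter_upwards [hfin] with t ht h0
    have h1 : Tendsto (fun n => ENNReal.ofReal (g n t)) atTop (𝓝 ⊤) := by
      refine ENNReal.tendsto_ofReal_nhds_top.2 ?_
      have h2 : ∀ n, g n t = log C + -log (ε n) := fun n => by
        simp [hg, hω, h0, max_eq_right (hε0 n).le, sub_eq_add_neg]
      simp_rw [h2]
      refine tendsto_atTop_add_const_left _ _ (tendsto_neg_atBot_atTop.comp ?_)
      exact tendsto_log_nhdsGT_zero.comp
        (tendsto_nhdsWithin_iff.2 ⟨hεlim, Eventually.of_forall hε0⟩)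
    rw [h1.liminf_eq] at ht
    exact lt_irrefl _ ht
  have hωlim : ∀ᵐ t ∂μ, ∀ᶠ n in atTop, ω n (circleMap 0 1 t) = log ‖u (circleMap 0 1 t)‖ := by
    filter_upwards [hune] with t ht
    filter_upwards [hεlim.eventually_lt_const (norm_pos_iff.2 ht)] with n hn
    simp only [hω, max_eq_left hn.le]
  have hum := (circleIntegrable_iff_integrable.1 hu).aestronglyMeasurable
  have hlogm : AEStronglyMeasurable (fun t => log ‖u (circleMap 0 1 t)‖) μ :=
    (measurable_log.comp_aemeasurable hum.norm.aemeasurable).aestronglyMeasurable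
  have hG0 : 0 ≤ᵐ[μ] fun t => log C - log ‖u (circleMap 0 1 t)‖ := by
    filter_upwards [ae_restrict_circle hC, hune] with t h1 h2
    simpa using log_le_log (norm_pos_iff.2 h2) h1
  have hGint : Integrable (fun t => log C - log ‖u (circleMap 0 1 t)‖) μ := by
    refine ⟨aestronglyMeasurable_const.sub hlogm, ?_⟩
    rw [hasFiniteIntegral_iff_ofReal hG0]
    refine lt_of_le_of_lt (lintegral_mono_ae ?_) (hfatou.trans_lt ENNReal.ofReal_lt_top)
    filter_upwards [hωlim] with t ht
    have h1 : Tendsto (fun n => ENNReal.ofReal (g n t)) atTop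
        (𝓝 (ENNReal.ofReal (log C - log ‖u (circleMap 0 1 t)‖))) := by
      refine tendsto_const_nhds.congr' ?_
      filter_upwards [ht] with n hn
      simp only [hg, hn]
    rw [h1.liminf_eq]
  have hlog : Integrable (fun t => log ‖u (circleMap 0 1 t)‖) μ := by
    simpa [Pi.sub_def] using (integrable_const (log C)).sub hGint
  have hlogc : CircleIntegrable (fun ζ => log ‖u ζ‖) 0 1 := circleIntegrable_iff_integrable.2 hlog
  refine ⟨ae_of_ae_restrict_circle (p := fun ζ => u ζ ≠ 0) hune, hlogc, fun w hw hfw => ?_⟩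
  have hlim : Tendsto (fun n => poissonIntegral (ω n) w) atTop
      (𝓝 (poissonIntegral (fun ζ => log ‖u ζ‖) w)) := by
    simp only [poissonIntegral_eq, intervalIntegral.integral_of_le two_pi_pos.le]
    refine Tendsto.const_smul ?_ _
    obtain ⟨A, hA, hAP⟩ := exists_poissonKernel_le hw
    refine tendsto_integral_of_dominated_convergence
      (fun t => A * (|log C| + |log ‖u (circleMap 0 1 t)‖|)) (fun n => ?_) ?_ (fun n => ?_) ?_
    · exact ((intervalIntegrable_iff_integrableOn_Ioc_of_le two_pi_pos.le).1
        (intervalIntegrable_poissonKernel_smul hw (hωint n))).aestronglyMeasurable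
    · exact ((integrable_const _).add hlog.abs).const_mul A
    · filter_upwards [hune, ae_restrict_circle (hωC n)] with t h1 h2
      rw [norm_smul, Real.norm_of_nonneg (poissonKernel_circleMap_pos hw t).le]
      refine mul_le_mul (hAP t) ?_ (norm_nonneg _) hA.le
      have h3 : log ‖u (circleMap 0 1 t)‖ ≤ ω n (circleMap 0 1 t) :=
        log_le_log (norm_pos_iff.2 h1) (le_max_left _ _)
      rw [Real.norm_eq_abs, abs_le]
      constructor
      · linarith [neg_abs_le (log ‖u (circleMap 0 1 t)‖), abs_nonneg (log C)]
      · linarith [le_abs_self (log C), abs_nonneg (log ‖u (circleMap 0 1 t)‖)]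
    · filter_upwards [hωlim] with t ht
      refine tendsto_const_nhds.congr' ?_
      filter_upwards [ht] with n hn
      rw [hn]
  exact ge_of_tendsto hlim (Eventually.of_forall fun n => hωle n w hw hfw)

/-- The inner-outer factorization of a bounded holomorphic function. -/
theorem IsHInfty.exists_inner_outer {f : ℂ → ℂ} (hf : IsHInfty f) (hne : ∃ w ∈ disk, f w ≠ 0) :
    ∃ (J G : ℂ → ℂ) (ω : ℂ → ℝ), IsInner J ∧ IsOuterWith ω G ∧ ∀ w ∈ disk, f w = J w * G w := by
  obtain ⟨u, hu, hfu⟩ := hf.exists_ae_tendsto_radial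
  obtain ⟨h0, hint, hle⟩ := hf.log_integrable_of_radial hu hfu hne
  have hU := isOuterWith_outerFunction hint
  refine ⟨fun w => f w / outerFunction (fun ζ => log ‖u ζ‖) w, outerFunction fun ζ => log ‖u ζ‖,
    fun ζ => log ‖u ζ‖, ⟨⟨hf.1.div hU.1 hU.2.1, 1, fun w hw => ?_⟩, ?_⟩, hU, fun w _ => ?_⟩
  · by_cases hfw : f w = 0
    · simp [hfw]
    · rw [norm_div, div_le_one (norm_pos_iff.2 (outerFunction_ne_zero _ w)),
        norm_outerFunction hint hw, ← log_le_iff_le_exp (norm_pos_iff.2 hfw)]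
      exact hle w hw hfw
  · filter_upwards [hfu, h0, hU.ae_tendsto_norm] with t h1 h2 h3
    have h4 := h1.norm.div h3 (exp_ne_zero _)
    rw [exp_log (norm_pos_iff.2 h2), div_self (norm_ne_zero_iff.2 h2)] at h4
    refine h4.congr fun r => ?_
    rw [Pi.div_apply, circleMap_zero, norm_div]
  · rw [div_mul_cancel₀ _ (outerFunction_ne_zero _ w)]

/-! ### The Smirnov class -/

theorem IsHInfty.mul {f g : ℂ → ℂ} (hf : IsHInfty f) (hg : IsHInfty g) :
    IsHInfty fun w => f w * g w := by
  obtain ⟨hf, A, hA⟩ := hf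
  obtain ⟨hg, B, hB⟩ := hg
  refine ⟨hf.mul hg, A * B, fun w hw => ?_⟩
  rw [norm_mul]
  exact mul_le_mul (hA w hw) (hB w hw) (norm_nonneg _) ((norm_nonneg _).trans (hA w hw))

theorem IsHInfty.add {f g : ℂ → ℂ} (hf : IsHInfty f) (hg : IsHInfty g) :
    IsHInfty fun w => f w + g w := by
  obtain ⟨hf, A, hA⟩ := hf
  obtain ⟨hg, B, hB⟩ := hg
  exact ⟨hf.add hg, A + B, fun w hw => (norm_add_le _ _).trans (add_le_add (hA w hw) (hB w hw))⟩

theorem IsOuter.mul {f g : ℂ → ℂ} (hf : IsOuter f) (hg : IsOuter g) :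
    IsOuter fun w => f w * g w := by
  obtain ⟨_, hf⟩ := isOuter_iff.1 hf
  obtain ⟨_, hg⟩ := isOuter_iff.1 hg
  exact isOuter_iff.2 ⟨_, hf.mul hg⟩

theorem IsHInfty.isSmirnov {f : ℂ → ℂ} (hf : IsHInfty f) : IsSmirnov f := by
  refine ⟨f, fun _ => 1, hf, ⟨differentiableOn_const _, 1, fun w _ => by simp⟩,
    isOuter_iff.2 ⟨fun _ => 0, differentiableOn_const _, fun _ _ => one_ne_zero,
      circleIntegrable_const _ _ _, fun w hw => ?_⟩, fun w _ => (div_one _).symm⟩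
  rw [poissonIntegral_const hw]
  simp

theorem IsSmirnov.mul {f g : ℂ → ℂ} (hf : IsSmirnov f) (hg : IsSmirnov g) :
    IsSmirnov fun w => f w * g w := by
  obtain ⟨u₁, v₁, hu₁, hv₁, ho₁, h₁⟩ := hf
  obtain ⟨u₂, v₂, hu₂, hv₂, ho₂, h₂⟩ := hg
  refine ⟨_, _, hu₁.mul hu₂, hv₁.mul hv₂, ho₁.mul ho₂, fun w hw => ?_⟩
  beta_reduce
  rw [h₁ w hw, h₂ w hw, div_mul_div_comm]

theorem IsSmirnov.add {f g : ℂ → ℂ} (hf : IsSmirnov f) (hg : IsSmirnov g) :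
    IsSmirnov fun w => f w + g w := by
  obtain ⟨u₁, v₁, hu₁, hv₁, ho₁, h₁⟩ := hf
  obtain ⟨u₂, v₂, hu₂, hv₂, ho₂, h₂⟩ := hg
  refine ⟨_, _, (hu₁.mul hv₂).add (hv₁.mul hu₂), hv₁.mul hv₂, ho₁.mul ho₂, fun w hw => ?_⟩
  beta_reduce
  rw [h₁ w hw, h₂ w hw, div_add_div _ _ (ho₁.2.1 w hw) (ho₂.2.1 w hw)]

theorem IsSmirnov.congr {f g : ℂ → ℂ} (hf : IsSmirnov f) (hfg : ∀ w ∈ disk, g w = f w) :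
    IsSmirnov g := by
  obtain ⟨u, v, hu, hv, ho, h⟩ := hf
  exact ⟨u, v, hu, hv, ho, fun w hw => (hfg w hw).trans (h w hw)⟩

theorem IsSmirnov.exists_inner_outer {f : ℂ → ℂ} (hf : IsSmirnov f) (hne : ∃ w ∈ disk, f w ≠ 0) :
    ∃ (J G : ℂ → ℂ) (ω : ℂ → ℝ), IsInner J ∧ IsOuterWith ω G ∧ ∀ w ∈ disk, f w = J w * G w := by
  obtain ⟨u, v, hu, -, hv, h⟩ := hf
  obtain ⟨w₀, hw₀, hfw₀⟩ := hne
  have hu0 : u w₀ ≠ 0 := fun h0 => hfw₀ (by rw [h w₀ hw₀, h0, zero_div])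
  obtain ⟨J, U, ω, hJ, hU, hJU⟩ := hu.exists_inner_outer ⟨w₀, hw₀, hu0⟩
  obtain ⟨ω', hv'⟩ := isOuter_iff.1 hv
  exact ⟨J, _, _, hJ, hU.div hv', fun w hw => by rw [h w hw, hJU w hw, mul_div_assoc]⟩

theorem ae_tendsto_norm_of_inner_outer {f J G : ℂ → ℂ} {ω : ℂ → ℝ} (hJ : IsInner J)
    (hG : IsOuterWith ω G) (hf : ∀ w ∈ disk, f w = J w * G w) :
    ∀ᵐ t : ℝ, Tendsto (fun r : ℝ => ‖f (circleMap 0 r t)‖) (𝓝[<] 1)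
      (𝓝 (exp (ω (circleMap 0 1 t)))) := by
  filter_upwards [hJ.2, hG.ae_tendsto_norm] with t h1 h2
  have h3 := h1.mul h2
  rw [one_mul] at h3
  refine h3.congr' ?_
  filter_upwards [Ioo_mem_nhdsLT (show (0 : ℝ) < 1 by norm_num)] with r hr
  rw [hf _ (circleMap_mem_disk hr.1.le hr.2 t), norm_mul, circleMap_zero]

/-! ### A boundary Schwarz–Pick estimate -/

theorem norm_one_sub_conj_mul_sq_sub (a w : ℂ) :
    ‖1 - (starRingEnd ℂ) a * w‖ ^ 2 - ‖a - w‖ ^ 2 = (1 - ‖a‖ ^ 2) * (1 - ‖w‖ ^ 2) := by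
  simp only [Complex.sq_norm, Complex.normSq_apply, Complex.sub_re, Complex.sub_im, Complex.mul_re,
    Complex.mul_im, Complex.conj_re, Complex.conj_im, Complex.one_re, Complex.one_im]
  ring

theorem one_sub_norm_le_norm_one_sub_conj_mul {a : ℂ} (ha : ‖a‖ ≤ 1) (w : ℂ) :
    1 - ‖w‖ ≤ ‖1 - (starRingEnd ℂ) a * w‖ := by
  have h1 := norm_sub_norm_le 1 ((starRingEnd ℂ) a * w)
  rw [norm_mul, RCLike.norm_conj, norm_one] at h1
  nlinarith [norm_nonneg w]

theorem norm_one_sub_conj_mul_pos {a w : ℂ} (ha : a ∈ disk) (hw : w ∈ disk) :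
    0 < ‖1 - (starRingEnd ℂ) a * w‖ :=
  (sub_pos.2 (mem_disk.1 hw)).trans_le
    (one_sub_norm_le_norm_one_sub_conj_mul (mem_disk.1 ha).le w)

theorem one_sub_pseudoDist_sq {a w : ℂ} (ha : a ∈ disk) (hw : w ∈ disk) :
    1 - pseudoDist a w ^ 2 =
      (1 - ‖a‖ ^ 2) * (1 - ‖w‖ ^ 2) / ‖1 - (starRingEnd ℂ) a * w‖ ^ 2 := by
  have h := norm_one_sub_conj_mul_pos ha hw
  rw [← norm_one_sub_conj_mul_sq_sub, pseudoDist, norm_div, div_pow, sub_div,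
    div_self (pow_pos h 2).ne']

theorem pseudoDist_nonneg (a w : ℂ) : 0 ≤ pseudoDist a w := norm_nonneg _

theorem pseudoDist_le_one {a w : ℂ} (ha : a ∈ disk) (hw : w ∈ disk) : pseudoDist a w ≤ 1 := by
  have h := one_sub_pseudoDist_sq ha hw
  have h1 : 0 ≤ 1 - pseudoDist a w ^ 2 := by
    rw [h]
    have := one_sub_norm_sq_pos ha
    have := one_sub_norm_sq_pos hw
    positivity
  nlinarith [pseudoDist_nonneg a w]

theorem norm_one_sub_conj_mul_circleMap (a : ℂ) (t : ℝ) :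
    ‖1 - (starRingEnd ℂ) a * circleMap 0 1 t‖ = ‖circleMap 0 1 t - a‖ := by
  have h := norm_one_sub_conj_mul_sq_sub a (circleMap 0 1 t)
  rw [norm_circleMap_zero_one, one_pow, sub_self, mul_zero, sub_eq_zero, norm_sub_rev a] at h
  exact (pow_left_inj₀ (norm_nonneg _) (norm_nonneg _) two_ne_zero).1 h

theorem hasDerivAt_circleMap_radius (r t : ℝ) :
    HasDerivAt (fun r : ℝ => circleMap 0 r t) (circleMap 0 1 t) r := by
  simp only [circleMap_zero, Complex.ofReal_one]
  exact (Complex.ofRealCLM.hasDerivAt (x := r)).mul_const _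

/-- If `f` is dominated by a Möbius transformation with zero `a` and has a radial limit of modulus
one at a boundary point, then the radial limit of `|f'|` there is at least the angular derivative of
the Möbius transformation, which is the Poisson kernel. -/
theorem poissonKernel_le_of_radial {f : ℂ → ℂ} (hf : DifferentiableOn ℂ f disk) {a : ℂ}
    (ha : a ∈ disk) (hfa : ∀ w ∈ disk, ‖f w‖ ≤ pseudoDist a w) {t : ℝ}
    (h1 : Tendsto (fun r : ℝ => ‖f (circleMap 0 r t)‖) (𝓝[<] 1) (𝓝 1)) {L : ℝ}
    (hL : Tendsto (fun r : ℝ => ‖deriv f (circleMap 0 r t)‖) (𝓝[<] 1) (𝓝 L)) :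
    poissonKernel 0 a (circleMap 0 1 t) ≤ L := by
  refine le_of_forall_gt_imp_ge_of_dense fun L' hL' => ?_
  have hev := hL.eventually_lt_const hL'
  obtain ⟨r₀, hr₀, hr₀'⟩ := (mem_nhdsLT_iff_exists_Ioo_subset' (show (0 : ℝ) < 1 by norm_num)).1
    (inter_mem hev (Ioo_mem_nhdsLT (show (0 : ℝ) < 1 by norm_num)))
  -- mean value inequality on `[r, s]`, then `s → 1`
  have hincr : ∀ r ∈ Ioo r₀ 1, 1 - ‖f (circleMap 0 r t)‖ ≤ L' * (1 - r) := by
    intro r hr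
    have hs : ∀ s ∈ Ioo r 1,
        ‖f (circleMap 0 s t)‖ - ‖f (circleMap 0 r t)‖ ≤ L' * (s - r) := by
      intro s hs
      refine (norm_sub_norm_le _ _).trans ?_
      refine norm_image_sub_le_of_norm_deriv_le_segment' (f := fun x => f (circleMap 0 x t))
        (f' := fun x => deriv f (circleMap 0 x t) * circleMap 0 1 t) (a := r) (b := s)
        (fun x hx => ?_) (fun x hx => ?_) s (right_mem_Icc.2 hs.1.le)
      · have hx' := hr₀' ⟨hr.1.trans_le hx.1, hx.2.trans_lt hs.2⟩
        have hd := hf.differentiableAt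
          (isOpen_disk.mem_nhds (circleMap_mem_disk hx'.2.1.le hx'.2.2 t))
        exact (hd.hasDerivAt.comp x (hasDerivAt_circleMap_radius x t)).hasDerivWithinAt
      · have hx' := hr₀' ⟨hr.1.trans_le hx.1, hx.2.trans hs.2⟩
        rw [norm_mul, norm_circleMap_zero_one, mul_one]
        exact hx'.1.le
    have hlim1 : Tendsto (fun s => ‖f (circleMap 0 s t)‖ - ‖f (circleMap 0 r t)‖) (𝓝[<] 1)
        (𝓝 (1 - ‖f (circleMap 0 r t)‖)) := h1.sub_const _
    have hlim2 : Tendsto (fun s : ℝ => L' * (s - r)) (𝓝[<] 1) (𝓝 (L' * (1 - r))) :=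
      (Continuous.tendsto (by fun_prop) 1).mono_left nhdsWithin_le_nhds
    refine le_of_tendsto_of_tendsto hlim1 hlim2 ?_
    filter_upwards [Ioo_mem_nhdsLT hr.2] with s hs' using hs s hs'
  have hle : ∀ r ∈ Ioo r₀ 1,
      (1 - ‖a‖ ^ 2) * (1 + r) / ‖1 - (starRingEnd ℂ) a * circleMap 0 r t‖ ^ 2 ≤ 2 * L' := by
    intro r hr
    have hr' := (hr₀' hr).2
    have hw := circleMap_mem_disk hr'.1.le hr'.2 t
    have h2 := hincr r hr
    have h3 := hfa _ hw
    have h4 := one_sub_pseudoDist_sq ha hw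
    rw [norm_circleMap_zero, sq_abs] at h4
    have h5 : (1 - ‖a‖ ^ 2) * (1 - r ^ 2) / ‖1 - (starRingEnd ℂ) a * circleMap 0 r t‖ ^ 2 =
        (1 - ‖a‖ ^ 2) * (1 + r) / ‖1 - (starRingEnd ℂ) a * circleMap 0 r t‖ ^ 2 * (1 - r) := by
      ring
    rw [h5] at h4
    have h6 : 0 < 1 - r := by linarith [hr'.2]
    refine le_of_mul_le_mul_right ?_ h6
    rw [← h4]
    -- `1 - ρ² ≤ 2 (1 - ρ)` for the pseudohyperbolic distance `ρ`
    nlinarith [sq_nonneg (1 - pseudoDist a (circleMap 0 r t))]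
  have hpos := norm_circleMap_sub_pos ha t
  have hlim : Tendsto (fun r : ℝ =>
      (1 - ‖a‖ ^ 2) * (1 + r) / ‖1 - (starRingEnd ℂ) a * circleMap 0 r t‖ ^ 2) (𝓝[<] 1)
      (𝓝 ((1 - ‖a‖ ^ 2) * (1 + 1) / ‖1 - (starRingEnd ℂ) a * circleMap 0 1 t‖ ^ 2)) := by
    have hc : ContinuousAt (fun r : ℝ => circleMap 0 r t) 1 :=
      (hasDerivAt_circleMap_radius 1 t).continuousAt
    have : ContinuousAt (fun r : ℝ =>
      (1 - ‖a‖ ^ 2) * (1 + r) / ‖1 - (starRingEnd ℂ) a * circleMap 0 r t‖ ^ 2) 1 := by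
      refine ContinuousAt.div (by fun_prop) (by fun_prop) ?_
      rw [norm_one_sub_conj_mul_circleMap]
      positivity
    exact this.tendsto.mono_left nhdsWithin_le_nhds
  have hfin := le_of_tendsto hlim (by
    filter_upwards [Ioo_mem_nhdsLT hr₀] with r hr using hle r hr)
  rw [norm_one_sub_conj_mul_circleMap] at hfin
  rw [poissonKernel_circleMap]
  have h7 : (1 - ‖a‖ ^ 2) * (1 + 1) / ‖circleMap 0 1 t - a‖ ^ 2 =
    2 * ((1 - ‖a‖ ^ 2) / ‖circleMap 0 1 t - a‖ ^ 2) := by ring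
  rw [h7] at hfin
  linarith

/-! ### Blaschke products -/

theorem norm_blaschkeFactor_const (a : ℂ) : ‖if a = 0 then (-1 : ℂ) else (‖a‖ : ℂ) / a‖ = 1 := by
  split_ifs with h
  · simp
  · rw [norm_div, Complex.norm_real, norm_norm, div_self (norm_ne_zero_iff.2 h)]

theorem norm_blaschkeFactor (a w : ℂ) : ‖blaschkeFactor a w‖ = pseudoDist a w := by
  rw [blaschkeFactor, norm_mul, norm_blaschkeFactor_const, one_mul, pseudoDist]

theorem one_sub_conj_mul_ne_zero {a w : ℂ} (ha : a ∈ disk) (hw : w ∈ disk) :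
    1 - (starRingEnd ℂ) a * w ≠ 0 := norm_pos_iff.1 (norm_one_sub_conj_mul_pos ha hw)

theorem differentiableOn_blaschkeFactor {a : ℂ} (ha : a ∈ disk) :
    DifferentiableOn ℂ (blaschkeFactor a) disk := by
  refine DifferentiableOn.const_mul (DifferentiableOn.div (by fun_prop) (by fun_prop) ?_) _
  exact fun w hw => one_sub_conj_mul_ne_zero ha hw

theorem norm_blaschkeFactor_sub_one_le {a w : ℂ} (ha : a ∈ disk) {R : ℝ} (hR : R < 1)
    (hw : ‖w‖ ≤ R) : ‖blaschkeFactor a w - 1‖ ≤ (1 - ‖a‖) * (2 / (1 - R)) := by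
  have hwd : w ∈ disk := mem_disk.2 (hw.trans_lt hR)
  have ha1 := mem_disk.1 ha
  have hden := norm_one_sub_conj_mul_pos ha hwd
  have hden' : 1 - R ≤ ‖1 - (starRingEnd ℂ) a * w‖ := by
    linarith [one_sub_norm_le_norm_one_sub_conj_mul ha1.le w]
  by_cases h : a = 0
  · subst h
    have h1 : ‖w - 1‖ ≤ 2 := by
      refine (norm_sub_le _ _).trans ?_
      rw [norm_one]; linarith
    have h2 : 2 ≤ 2 / (1 - R) := by
      rw [le_div_iff₀ (by linarith)]
      nlinarith [norm_nonneg w]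
    simpa [blaschkeFactor] using h1.trans h2
  have hna : 0 < ‖a‖ := norm_pos_iff.2 h
  have hconj : (starRingEnd ℂ) a * a = (‖a‖ : ℂ) * ‖a‖ := by
    rw [mul_comm, Complex.mul_conj']; ring
  have hne := one_sub_conj_mul_ne_zero ha hwd
  have key : blaschkeFactor a w - 1 =
      -((1 - ‖a‖ : ℝ) * (a + ‖a‖ * w)) / (a * (1 - (starRingEnd ℂ) a * w)) := by
    rw [blaschkeFactor, if_neg h, div_mul_div_comm, eq_div_iff (mul_ne_zero h hne), sub_mul,
      div_mul_cancel₀ _ (mul_ne_zero h hne)]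
    push_cast
    linear_combination w * hconj
  rw [key, norm_div, norm_neg, norm_mul, norm_mul, Complex.norm_real,
    Real.norm_of_nonneg (by linarith), div_le_iff₀ (mul_pos hna hden)]
  have h1 : ‖a + ‖a‖ * w‖ ≤ 2 * ‖a‖ := by
    refine (norm_add_le _ _).trans ?_
    rw [norm_mul, Complex.norm_real, norm_norm]
    nlinarith
  calc (1 - ‖a‖) * ‖a + ‖a‖ * w‖ ≤ (1 - ‖a‖) * (2 * ‖a‖) :=
        mul_le_mul_of_nonneg_left h1 (by linarith)
    _ = (1 - ‖a‖) * (2 / (1 - R)) * (‖a‖ * (1 - R)) := by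
        have : 1 - R ≠ 0 := by linarith
        field_simp
    _ ≤ _ := by
        refine mul_le_mul_of_nonneg_left (mul_le_mul_of_nonneg_left hden' hna.le) ?_
        exact mul_nonneg (by linarith) (div_nonneg zero_le_two (by linarith))

section Product

variable {ι : Type*} {z : ι → ℂ}

theorem multipliable_blaschkeFactor (hz : ∀ i, z i ∈ disk) (hs : Summable fun i => 1 - ‖z i‖)
    {w : ℂ} (hw : w ∈ disk) : Multipliable fun i => blaschkeFactor (z i) w := by
  have h := multipliable_one_add_of_summable (f := fun i => blaschkeFactor (z i) w - 1)
    ((hs.mul_right (2 / (1 - ‖w‖))).of_nonneg_of_le (fun _ => norm_nonneg _)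
      fun i => norm_blaschkeFactor_sub_one_le (hz i) (mem_disk.1 hw) le_rfl)
  simpa using h

theorem norm_tprod_blaschkeFactor (hz : ∀ i, z i ∈ disk) (hs : Summable fun i => 1 - ‖z i‖)
    {w : ℂ} (hw : w ∈ disk) :
    ‖∏' i, blaschkeFactor (z i) w‖ = ∏' i, pseudoDist (z i) w := by
  rw [(multipliable_blaschkeFactor hz hs hw).norm_tprod]
  simp_rw [norm_blaschkeFactor]

theorem hasProd_pseudoDist (hz : ∀ i, z i ∈ disk) (hs : Summable fun i => 1 - ‖z i‖)
    {w : ℂ} (hw : w ∈ disk) :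
    HasProd (fun i => pseudoDist (z i) w) ‖∏' i, blaschkeFactor (z i) w‖ := by
  have h := (multipliable_blaschkeFactor hz hs hw).hasProd.norm
  simpa only [norm_blaschkeFactor] using h

theorem norm_tprod_blaschkeFactor_le_one (hz : ∀ i, z i ∈ disk)
    (hs : Summable fun i => 1 - ‖z i‖) {w : ℂ} (hw : w ∈ disk) :
    ‖∏' i, blaschkeFactor (z i) w‖ ≤ 1 :=
  le_of_tendsto (hasProd_pseudoDist hz hs hw) (Eventually.of_forall fun _ =>
    Finset.prod_le_one (fun _ _ => pseudoDist_nonneg _ _) fun i _ => pseudoDist_le_one (hz i) hw)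

theorem differentiableOn_tprod_blaschkeFactor (hz : ∀ i, z i ∈ disk)
    (hs : Summable fun i => 1 - ‖z i‖) :
    DifferentiableOn ℂ (fun w => ∏' i, blaschkeFactor (z i) w) disk := by
  intro w hw
  obtain ⟨R, hwR, hR⟩ := exists_between (mem_disk.1 hw)
  have hsub : ball (0 : ℂ) R ⊆ disk := ball_subset_ball hR.le
  have h := (hs.mul_right (2 / (1 - R))).hasProdLocallyUniformlyOn_one_add
    (f := fun i w => blaschkeFactor (z i) w - 1) (isOpen_ball (x := (0 : ℂ)) (ε := R))
    (Eventually.of_forall fun i w hw =>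
      norm_blaschkeFactor_sub_one_le (hz i) hR (mem_ball_zero_iff.1 hw).le)
    (fun i => ((differentiableOn_blaschkeFactor (hz i)).mono hsub).continuousOn.sub
      continuousOn_const)
  simp only [add_sub_cancel] at h
  have hd : DifferentiableOn ℂ (fun w => ∏' i, blaschkeFactor (z i) w) (ball 0 R) := by
    refine TendstoLocallyUniformlyOn.differentiableOn
      (hasProdLocallyUniformlyOn_iff_tendstoLocallyUniformlyOn.1 h)
      (Eventually.of_forall fun _ => ?_) isOpen_ball
    exact DifferentiableOn.fun_finsetProd fun i _ =>
      (differentiableOn_blaschkeFactor (hz i)).mono hsub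
  exact (hd.differentiableAt
    (isOpen_ball.mem_nhds (mem_ball_zero_iff.2 hwR))).differentiableWithinAt

theorem one_sub_sum_le_prod {s : Finset ι} {x : ι → ℝ} (hx : ∀ i, x i ∈ Icc (0 : ℝ) 1) :
    1 - ∑ i ∈ s, (1 - x i) ≤ ∏ i ∈ s, x i := by
  classical
  induction s using Finset.induction_on with
  | empty => simp
  | insert i s hi ih =>
    rw [Finset.sum_insert hi, Finset.prod_insert hi]
    have h1 : ∏ i ∈ s, x i ≤ 1 := Finset.prod_le_one (fun i _ => (hx i).1) fun i _ => (hx i).2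
    nlinarith [(hx i).1, (hx i).2]

theorem blaschkeProduct_eq_mul {z : ℕ → ℂ} (hz : ∀ n, z n ∈ disk)
    (hs : Summable fun n => 1 - ‖z n‖) (k : ℕ) {w : ℂ} (hw : w ∈ disk) :
    blaschkeProduct z w =
      blaschkeFactor (z k) w * ∏' j : {j : ℕ // j ≠ k}, blaschkeFactor (z j) w := by
  have h1 : HasProd ((fun n => blaschkeFactor (z n) w) ∘ ((↑) : ({k} : Set ℕ) → ℕ))
      (blaschkeFactor (z k) w) := hasProd_singleton k fun n => blaschkeFactor (z n) w
  have h2 := (multipliable_blaschkeFactor (z := fun j : {j : ℕ // j ≠ k} => z j) (fun j => hz j)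
    (hs.comp_injective Subtype.val_injective) hw).hasProd
  exact (h1.mul_compl h2).tprod_eq

/-- Away from the accumulation point `1` of its zeros, a Blaschke product has radial limits of
modulus one. -/
theorem tendsto_norm_blaschkeProduct {z : ℕ → ℂ} (hz : ∀ n, z n ∈ disk)
    (hs : Summable fun n => 1 - ‖z n‖) (hlim : Tendsto z atTop (𝓝 1)) {t : ℝ}
    (ht : circleMap 0 1 t ≠ 1) :
    Tendsto (fun r : ℝ => ‖blaschkeProduct z (circleMap 0 r t)‖) (𝓝[<] 1) (𝓝 1) := by
  set d : ℝ := ‖1 - circleMap 0 1 t‖ with hd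
  have hdpos : 0 < d := norm_pos_iff.2 (sub_ne_zero.2 ht.symm)
  -- `S n` is a lower bound for the `n`-th denominator that does not depend on the radius
  set S : ℕ → ℝ := fun n => if ‖1 - z n‖ ≤ d / 4 then d / 4 else 1 - ‖z n‖ with hS
  have hSpos : ∀ n, 0 < S n := fun n => by
    simp only [hS]
    split_ifs
    · positivity
    · linarith [mem_disk.1 (hz n)]
  have hden : ∀ r ∈ Ioo (0 : ℝ) 1, ∀ n, S n ≤ ‖1 - (starRingEnd ℂ) (z n) * circleMap 0 r t‖ := by
    intro r hr n
    have hw := circleMap_mem_disk hr.1.le hr.2 t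
    have hnr : ‖circleMap 0 r t‖ = r := by rw [norm_circleMap_zero, abs_of_pos hr.1]
    simp only [hS]
    split_ifs with hn
    · have h1 : d ≤ ‖1 - circleMap 0 r t‖ + (1 - r) := by
        have h2 : 1 - circleMap 0 1 t =
            (1 - circleMap 0 r t) - ((1 - r : ℝ) : ℂ) * circleMap 0 1 t := by
          rw [← ofReal_mul_circleMap r t]; push_cast; ring
        rw [hd, h2]
        refine (norm_sub_le _ _).trans_eq ?_
        rw [norm_mul, norm_circleMap_zero_one, mul_one, Complex.norm_real,
          Real.norm_of_nonneg (by linarith [hr.2])]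
      have h3 : 1 - r ≤ ‖1 - circleMap 0 r t‖ := by
        have := norm_sub_norm_le 1 (circleMap 0 r t)
        rwa [norm_one, hnr] at this
      have h4 : ‖1 - circleMap 0 r t‖ ≤
          ‖1 - (starRingEnd ℂ) (z n) * circleMap 0 r t‖ + ‖1 - z n‖ := by
        have h5 : 1 - circleMap 0 r t = (1 - (starRingEnd ℂ) (z n) * circleMap 0 r t) -
          (starRingEnd ℂ) (1 - z n) * circleMap 0 r t := by
          rw [map_sub, map_one]; ring
        rw [h5]
        refine (norm_sub_le _ _).trans ?_
        rw [norm_mul, RCLike.norm_conj, hnr]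
        have : ‖1 - z n‖ * r ≤ ‖1 - z n‖ := mul_le_of_le_one_right (norm_nonneg _) hr.2.le
        linarith
      linarith
    · have := norm_sub_norm_le 1 ((starRingEnd ℂ) (z n) * circleMap 0 r t)
      rw [norm_one, norm_mul, RCLike.norm_conj, hnr] at this
      have h6 : ‖z n‖ * r ≤ ‖z n‖ := mul_le_of_le_one_right (norm_nonneg _) hr.2.le
      linarith
  set T : ℕ → ℝ := fun n => (1 - ‖z n‖ ^ 2) / S n ^ 2 with hT
  have hT0 : ∀ n, 0 ≤ T n := fun n =>
    div_nonneg (one_sub_norm_sq_pos (hz n)).le (sq_nonneg _)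
  have hTs : Summable T := by
    refine Summable.of_norm_bounded_eventually_nat (hs.mul_right (2 / (d / 4) ^ 2)) ?_
    have h1 : Tendsto (fun n => ‖1 - z n‖) atTop (𝓝 0) := by
      simpa using (hlim.const_sub 1).norm
    filter_upwards [h1.eventually_le_const (show (0 : ℝ) < d / 4 by positivity)] with n hn
    rw [Real.norm_of_nonneg (hT0 n)]
    simp only [hT, hS, if_pos hn]
    rw [← mul_div_assoc]
    gcongr
    have := mem_disk.1 (hz n)
    nlinarith [norm_nonneg (z n)]
  have hlow : ∀ r ∈ Ioo (0 : ℝ) 1, 1 - (1 - r ^ 2) * ∑' n, T n ≤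
      ‖blaschkeProduct z (circleMap 0 r t)‖ ^ 2 := by
    intro r hr
    have hw := circleMap_mem_disk hr.1.le hr.2 t
    have hr2 : 0 < 1 - r ^ 2 := by nlinarith [hr.1, hr.2]
    have hprod := (hasProd_pseudoDist hz hs hw).pow 2
    refine ge_of_tendsto hprod (Eventually.of_forall fun s => ?_)
    refine le_trans ?_ (one_sub_sum_le_prod (s := s)
      (x := fun n => pseudoDist (z n) (circleMap 0 r t) ^ 2) fun n =>
        ⟨sq_nonneg _, pow_le_one₀ (pseudoDist_nonneg _ _) (pseudoDist_le_one (hz n) hw)⟩)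
    refine sub_le_sub_left ?_ 1
    calc ∑ n ∈ s, (1 - pseudoDist (z n) (circleMap 0 r t) ^ 2)
        ≤ ∑ n ∈ s, (1 - r ^ 2) * T n := by
          refine Finset.sum_le_sum fun n _ => ?_
          rw [one_sub_pseudoDist_sq (hz n) hw, norm_circleMap_zero, sq_abs,
            mul_comm (1 - ‖z n‖ ^ 2), mul_div_assoc]
          have h1 := hSpos n
          have h2 := hden r hr n
          refine mul_le_mul_of_nonneg_left (div_le_div_of_nonneg_left
            (one_sub_norm_sq_pos (hz n)).le (by positivity) (by gcongr)) hr2.le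
      _ = (1 - r ^ 2) * ∑ n ∈ s, T n := by rw [Finset.mul_sum]
      _ ≤ _ := mul_le_mul_of_nonneg_left (hTs.sum_le_tsum s fun n _ => hT0 n) hr2.le
  have hsq : Tendsto (fun r : ℝ => ‖blaschkeProduct z (circleMap 0 r t)‖ ^ 2) (𝓝[<] 1) (𝓝 1) := by
    have h1 : Tendsto (fun r : ℝ => 1 - (1 - r ^ 2) * ∑' n, T n) (𝓝[<] 1) (𝓝 1) := by
      have : Continuous fun r : ℝ => 1 - (1 - r ^ 2) * ∑' n, T n := by fun_prop
      have h2 := (this.tendsto 1).mono_left (nhdsWithin_le_nhds (s := Iio 1))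
      simpa using h2
    refine tendsto_of_tendsto_of_tendsto_of_le_of_le' h1 tendsto_const_nhds ?_ ?_
    · filter_upwards [Ioo_mem_nhdsLT (show (0 : ℝ) < 1 by norm_num)] with r hr using hlow r hr
    · filter_upwards [Ioo_mem_nhdsLT (show (0 : ℝ) < 1 by norm_num)] with r hr
      exact pow_le_one₀ (norm_nonneg _)
        (norm_tprod_blaschkeFactor_le_one hz hs (circleMap_mem_disk hr.1.le hr.2 t))
  have := (Real.continuous_sqrt.tendsto 1).comp hsq
  rw [Real.sqrt_one] at this
  exact this.congr fun r => Real.sqrt_sq (norm_nonneg _)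

/-- The derivative at `a` of a product with a Blaschke factor with zero `a`. -/
theorem norm_deriv_blaschkeFactor_mul {a : ℂ} (ha : a ∈ disk) {g : ℂ → ℂ}
    (hg : DifferentiableAt ℂ g a) :
    ‖deriv (fun w => blaschkeFactor a w * g w) a‖ * (1 - ‖a‖ ^ 2) = ‖g a‖ := by
  set c : ℂ := if a = 0 then -1 else (‖a‖ : ℂ) / a with hc
  have hne := one_sub_conj_mul_ne_zero ha ha
  have h1 : HasDerivAt (blaschkeFactor a) (c * (-1 / (1 - (starRingEnd ℂ) a * a))) a := by
    have h2 : HasDerivAt (fun w => a - w) (-1) a := by simpa using (hasDerivAt_id a).const_sub a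
    have h3 : HasDerivAt (fun w => 1 - (starRingEnd ℂ) a * w) (-(starRingEnd ℂ) a) a := by
      simpa using ((hasDerivAt_id a).const_mul ((starRingEnd ℂ) a)).const_sub 1
    refine ((h2.fun_div h3 hne).const_mul c).congr_deriv ?_
    rw [sub_self, zero_mul, sub_zero, pow_two, mul_div_mul_right _ _ hne]
  have h0 : blaschkeFactor a a = 0 := by simp [blaschkeFactor]
  rw [(h1.fun_mul hg.hasDerivAt).deriv, h0, zero_mul, add_zero, norm_mul, norm_mul, norm_div,
    hc, norm_blaschkeFactor_const, one_mul, norm_neg, norm_one]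
  have h4 : ‖1 - (starRingEnd ℂ) a * a‖ = 1 - ‖a‖ ^ 2 := by
    rw [mul_comm, Complex.mul_conj']
    rw [← Complex.ofReal_pow, ← Complex.ofReal_one, ← Complex.ofReal_sub, Complex.norm_real,
      Real.norm_of_nonneg (one_sub_norm_sq_pos ha).le]
  rw [h4]
  field_simp [(one_sub_norm_sq_pos ha).ne']

end Product

/-! ### Lower bounds for outer functions -/

theorem circleIntegrable_log_poissonKernel {a : ℂ} (ha : a ∈ disk) :
    CircleIntegrable (fun ζ => log (poissonKernel 0 a ζ)) 0 1 :=
  ((continuous_poissonKernel_circleMap ha).log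
    fun t => (poissonKernel_circleMap_pos ha t).ne').intervalIntegrable _ _

/-- On the circle, `log (poissonKernel 0 a)` agrees with a harmonic function on a neighborhood of
the closed disk, whose value at `a` is computed here. -/
theorem poissonIntegral_log_poissonKernel {a : ℂ} (ha : a ∈ disk) :
    poissonIntegral (fun ζ => log (poissonKernel 0 a ζ)) a = -log (1 - ‖a‖ ^ 2) := by
  set h : ℂ → ℝ := (fun _ => log (1 - ‖a‖ ^ 2)) -
    (2 : ℝ) • fun w => log ‖1 - (starRingEnd ℂ) a * w‖ with hh
  have hharm : InnerProductSpace.HarmonicOnNhd h (closedBall 0 1) := by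
    intro w hw
    refine (InnerProductSpace.harmonicAt_const _).sub
      (InnerProductSpace.HarmonicAt.const_smul (AnalyticAt.harmonicAt_log_norm (by fun_prop) ?_))
    intro h0
    have h1 : (starRingEnd ℂ) a * w = 1 := (sub_eq_zero.1 h0).symm
    have h2 := congrArg norm h1
    rw [norm_mul, RCLike.norm_conj, norm_one] at h2
    have h3 := mem_disk.1 ha
    have h4 := mem_closedBall_zero_iff.1 hw
    nlinarith [norm_nonneg a, norm_nonneg w]
  have hP := hharm.circleAverage_poissonKernel_smul ha
  have ha2 := one_sub_norm_sq_pos ha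
  have h1 : poissonIntegral (fun ζ => log (poissonKernel 0 a ζ)) a = h a := by
    rw [← hP, poissonIntegral]
    refine circleAverage_congr_sphere fun ζ hζ => ?_
    rw [abs_one] at hζ
    obtain ⟨t, rfl⟩ : ∃ t, circleMap 0 1 t = ζ := by
      have : ζ ∈ range (circleMap 0 1) := by rw [range_circleMap, abs_one]; exact hζ
      exact this
    have hpos := norm_circleMap_sub_pos ha t
    simp only [Pi.smul_apply', hh, Pi.sub_apply, Pi.smul_apply, smul_eq_mul,
      norm_one_sub_conj_mul_circleMap]
    rw [poissonKernel_circleMap, log_div ha2.ne' (by positivity), log_pow]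
    norm_num
  have h4 : ‖1 - (starRingEnd ℂ) a * a‖ = 1 - ‖a‖ ^ 2 := by
    rw [mul_comm, Complex.mul_conj', ← Complex.ofReal_pow, ← Complex.ofReal_one,
      ← Complex.ofReal_sub, Complex.norm_real, Real.norm_of_nonneg ha2.le]
  rw [h1]
  simp only [hh, Pi.sub_apply, Pi.smul_apply, smul_eq_mul, h4]
  ring

/-- If `log P_a ≤ ω` on an arc and `P_a ≤ κ ≤ 1` off the arc, then the Poisson integral of `ω` at
`a` is almost at least that of `log P_a`. -/
theorem neg_log_sub_le_poissonIntegral {ω : ℂ → ℝ} (hω : CircleIntegrable ω 0 1) {a : ℂ}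
    (ha : a ∈ disk) {t₀ κ : ℝ} (hκ0 : 0 ≤ κ) (hκ : κ ≤ 1)
    (hoff : ∀ t ∈ Icc t₀ (2 * π), poissonKernel 0 a (circleMap 0 1 t) ≤ κ)
    (hon : ∀ᵐ t : ℝ, t ∈ Ioo 0 t₀ →
      log (poissonKernel 0 a (circleMap 0 1 t)) ≤ ω (circleMap 0 1 t)) :
    -log (1 - ‖a‖ ^ 2) - κ * circleAverage |ω| 0 1 ≤ poissonIntegral ω a := by
  have hP := circleIntegrable_log_poissonKernel ha
  rw [← poissonIntegral_log_poissonKernel ha, sub_le_iff_le_add, ← sub_le_iff_le_add',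
    ← poissonIntegral_sub ha hP hω, poissonIntegral_eq, circleAverage_def, smul_eq_mul, smul_eq_mul,
    mul_left_comm, ← intervalIntegral.integral_const_mul κ]
  refine mul_le_mul_of_nonneg_left ?_ (by positivity)
  rw [intervalIntegral.integral_of_le two_pi_pos.le, intervalIntegral.integral_of_le two_pi_pos.le]
  have hint : Integrable (fun t => |ω| (circleMap 0 1 t)) (volume.restrict (Ioc 0 (2 * π))) :=
    circleIntegrable_iff_integrable.1 hω.abs
  refine integral_mono_ae ((intervalIntegrable_iff_integrableOn_Ioc_of_le two_pi_pos.le).1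
    (intervalIntegrable_poissonKernel_smul ha (hP.sub hω))) (hint.const_mul κ) ?_
  filter_upwards [ae_restrict_circle hon, ae_restrict_mem measurableSet_Ioc] with t h1 h2
  have hpos := poissonKernel_circleMap_pos ha t
  simp only [Pi.sub_apply, smul_eq_mul, Pi.abs_apply]
  rcases lt_or_ge t t₀ with ht | ht
  · have h3 := h1 ⟨h2.1, ht⟩
    have h4 : poissonKernel 0 a (circleMap 0 1 t) *
        (log (poissonKernel 0 a (circleMap 0 1 t)) - ω (circleMap 0 1 t)) ≤ 0 :=
      mul_nonpos_of_nonneg_of_nonpos hpos.le (by linarith)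
    exact h4.trans (mul_nonneg hκ0 (abs_nonneg _))
  · have h3 := hoff t ⟨ht, h2.2⟩
    have h4 : log (poissonKernel 0 a (circleMap 0 1 t)) ≤ 0 :=
      log_nonpos hpos.le (h3.trans hκ)
    have h5 := neg_abs_le (ω (circleMap 0 1 t))
    have h6 := abs_nonneg (ω (circleMap 0 1 t))
    calc _ ≤ poissonKernel 0 a (circleMap 0 1 t) * |ω (circleMap 0 1 t)| :=
          mul_le_mul_of_nonneg_left (by linarith) hpos.le
      _ ≤ _ := mul_le_mul_of_nonneg_right h3 h6

theorem circleMap_zero_one_zero : circleMap 0 1 0 = 1 := by simp [circleMap_zero]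

/-- Points of the upper half plane near `1` are far, relative to their distance from `1`, from the
part of the circle complementary to an arc that starts at `1` and runs into the upper half
plane. -/
theorem exists_mul_norm_one_sub_le {t₀ : ℝ} (h0 : 0 < t₀) (hπ : t₀ ≤ π) :
    ∃ c : ℝ, 0 < c ∧ ∀ᶠ a in 𝓝 (1 : ℂ), 0 < a.im → ∀ t ∈ Icc t₀ (2 * π),
      c * ‖1 - a‖ ≤ ‖circleMap 0 1 t - a‖ := by
  have hnorm : ∀ t, ‖circleMap 0 1 t - 1‖ ^ 2 = 2 * (1 - cos t) := fun t => by
    have := norm_circleMap_sub_circleMap_sq 1 0 t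
    rw [circleMap_zero_one_zero, zero_add] at this
    simpa using this
  set d := ‖circleMap 0 1 t₀ - 1‖ with hd
  have hdpos : 0 < d := by
    have h1 : cos t₀ < 1 := by
      rw [← cos_zero]; exact cos_lt_cos_of_nonneg_of_le_pi le_rfl hπ h0
    have h2 := hnorm t₀
    refine (norm_nonneg _).lt_of_ne fun h3 => ?_
    rw [← h3] at h2
    linarith
  refine ⟨min (d / 2) (1 / 3), by positivity, ?_⟩
  have hball : ∀ᶠ a in 𝓝 (1 : ℂ), ‖1 - a‖ ≤ min (d / 2) (1 / 2) := by
    have h1 : Tendsto (fun a : ℂ => ‖1 - a‖) (𝓝 1) (𝓝 0) := by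
      have : Continuous fun a : ℂ => ‖1 - a‖ := by fun_prop
      simpa using this.tendsto 1
    exact h1.eventually_le_const (by positivity)
  filter_upwards [hball] with a ha him t ht
  have ha1 : ‖1 - a‖ ≤ d / 2 := ha.trans (min_le_left _ _)
  have ha2 : ‖1 - a‖ ≤ 1 / 2 := ha.trans (min_le_right _ _)
  have hn := norm_nonneg (1 - a)
  set ζ := circleMap 0 1 t with hζ
  have htri : ‖ζ - 1‖ ≤ ‖ζ - a‖ + ‖1 - a‖ := by
    rw [norm_sub_rev 1 a]
    simpa using norm_add_le (ζ - a) (a - 1)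
  have htri' : ‖1 - a‖ ≤ ‖ζ - a‖ + ‖ζ - 1‖ := by
    rw [norm_sub_rev ζ 1, add_comm]
    simpa using norm_add_le (1 - ζ) (ζ - a)
  have hm1 : min (d / 2) (1 / 3) * ‖1 - a‖ ≤ d / 2 * ‖1 - a‖ := by gcongr; exact min_le_left _ _
  have hm2 : min (d / 2) (1 / 3) * ‖1 - a‖ ≤ 1 / 3 * ‖1 - a‖ := by gcongr; exact min_le_right _ _
  rcases le_total t π with htπ | htπ
  · have h1 : d ≤ ‖ζ - 1‖ := by
      have h2 := cos_le_cos_of_nonneg_of_le_pi h0.le htπ ht.1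
      refine le_of_sq_le_sq ?_ (norm_nonneg _)
      rw [hd, hnorm, hζ, hnorm]
      linarith
    nlinarith
  have hζre : ζ.re = cos t := by simp [hζ, circleMap_zero, Complex.exp_ofReal_mul_I_re]
  have hζim : ζ.im = sin t := by simp [hζ, circleMap_zero, Complex.exp_ofReal_mul_I_im]
  have hsin : sin t ≤ 0 := by
    have := sin_nonneg_of_nonneg_of_le_pi (x := t - π) (by linarith) (by linarith [ht.2])
    rw [sin_sub_pi] at this
    linarith
  have hsq := hnorm t
  rw [← hζ] at hsq
  rcases le_total (cos t) 0 with hc | hc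
  · have h1 : 1 ≤ ‖ζ - 1‖ := by
      refine le_of_sq_le_sq ?_ (norm_nonneg _)
      rw [hsq]; linarith
    linarith
  · have h1 : -sin t ≤ ‖ζ - a‖ := by
      have := (neg_le_abs _).trans (Complex.abs_im_le_norm (ζ - a))
      rw [Complex.sub_im, hζim] at this
      linarith
    have h2 : ‖ζ - 1‖ ≤ 2 * ‖ζ - a‖ := by
      refine le_of_sq_le_sq ?_ (by positivity)
      rw [hsq]
      nlinarith [sin_sq_add_cos_sq t, cos_le_one t]
    linarith

/-! ### Analytic continuation of inner functions -/

/-- An inner function that continues analytically across `1` has modulus tending to one there. -/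
theorem IsInner.tendsto_norm_of_continuation {J g : ℂ → ℂ} (hJ : IsInner J)
    (hg : AnalyticAt ℂ g 1) (hgJ : g =ᶠ[𝓝[disk] 1] J) :
    Tendsto (fun w => ‖J w‖) (𝓝[disk] 1) (𝓝 1) := by
  have hlim : Tendsto (fun w => ‖J w‖) (𝓝[disk] 1) (𝓝 ‖g 1‖) :=
    (hg.continuousAt.norm.tendsto.mono_left nhdsWithin_le_nhds).congr'
      (hgJ.mono fun w hw => by rw [hw])
  suffices h : ‖g 1‖ = 1 by rwa [h] at hlim
  by_contra hne
  have hnear : ∀ᶠ w in 𝓝 (1 : ℂ), ContinuousAt g w ∧ ‖g w‖ ≠ 1 ∧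
      ∀ᶠ v in 𝓝 w, v ∈ disk → g v = J v :=
    hg.eventually_continuousAt.and ((hg.continuousAt.norm.eventually_ne hne).and
      (eventually_nhdsWithin_iff.1 hgJ).eventually_nhds)
  have hcirc : Tendsto (fun t => circleMap 0 1 t) (𝓝 0) (𝓝 1) := by
    have := (continuous_circleMap 0 1).tendsto 0
    rwa [circleMap_zero_one_zero] at this
  obtain ⟨t, ht, hc, hn, hv⟩ :=
    (Measure.dense_of_ae hJ.2).inter_nhds_nonempty (hcirc.eventually hnear)
  have hrad : Tendsto (fun r : ℝ => circleMap 0 r t) (𝓝[<] 1) (𝓝 (circleMap 0 1 t)) :=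
    (hasDerivAt_circleMap_radius 1 t).continuousAt.tendsto.mono_left nhdsWithin_le_nhds
  refine hn (tendsto_nhds_unique (hc.norm.tendsto.comp hrad) (ht.congr' ?_))
  filter_upwards [hrad.eventually hv, Ioo_mem_nhdsLT (show (0 : ℝ) < 1 by norm_num)] with r h1 hr
  rw [Function.comp_apply, h1 (circleMap_mem_disk hr.1.le hr.2 t), circleMap_zero]

/-! ### The derivative of `B F` -/

theorem InDiskAlgebra.isHInfty {f : ℂ → ℂ} (hf : InDiskAlgebra f) : IsHInfty f := by
  obtain ⟨hd, g, hg, hgf⟩ := hf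
  obtain ⟨C, hC⟩ := (isCompact_closedBall (0 : ℂ) 1).exists_bound_of_continuousOn hg
  exact ⟨hd, C, fun w hw => hgf w hw ▸ hC w (ball_subset_closedBall hw)⟩

theorem HasSupNorm.norm_le {f : ℂ → ℂ} {M : ℝ} (hf : HasSupNorm f M) {w : ℂ} (hw : w ∈ disk) :
    ‖f w‖ ≤ M := hf.1 (mem_image_of_mem _ hw)

theorem deriv_eq_of_eqOn_disk {f g : ℂ → ℂ} (hfg : ∀ w ∈ disk, f w = g w) {w : ℂ}
    (hw : w ∈ disk) : deriv f w = deriv g w :=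
  (eventuallyEq_of_mem (isOpen_disk.mem_nhds hw) hfg).deriv_eq

theorem norm_one_sub_pos_of_im_pos {a : ℂ} (ha : 0 < a.im) : 0 < ‖1 - a‖ := by
  rw [norm_pos_iff, sub_ne_zero]
  rintro rfl
  simp at ha

theorem summable_one_sub_norm {z : ℕ → ℂ} (hz : ∀ n, z n ∈ disk)
    (hzim : ∀ n, 0 < (z n).im)
    (hzsum : Summable fun n => (1 - ‖z n‖ ^ 2) / ‖1 - z n‖ ^ 2) :
    Summable fun n => 1 - ‖z n‖ := by
  refine (hzsum.mul_right 4).of_nonneg_of_le (fun n => ?_) fun n => ?_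
  · linarith [mem_disk.1 (hz n)]
  · have h1 := mem_disk.1 (hz n)
    have h2 := norm_nonneg (z n)
    have h3 := norm_one_sub_pos_of_im_pos (hzim n)
    have h4 : ‖1 - z n‖ ≤ 2 := (norm_sub_le _ _).trans (by rw [norm_one]; linarith)
    rw [div_mul_eq_mul_div, le_div_iff₀ (by positivity)]
    have h5 : ‖1 - z n‖ ^ 2 ≤ 4 := by nlinarith
    calc (1 - ‖z n‖) * ‖1 - z n‖ ^ 2 ≤ (1 - ‖z n‖) * 4 :=
          mul_le_mul_of_nonneg_left h5 (by linarith)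
      _ ≤ (1 - ‖z n‖ ^ 2) * 4 := by nlinarith

theorem ne_one_of_mem_arc {t₀ : ℝ} (ht₀π : t₀ ≤ π) {t : ℝ} (ht : t ∈ Ioo 0 t₀) :
    circleMap 0 1 t ≠ 1 := by
  intro h
  have h1 := sin_pos_of_pos_of_lt_pi ht.1 (ht.2.trans_le ht₀π)
  have h2 := congrArg Complex.im h
  rw [circleMap_zero, Complex.ofReal_one, one_mul, Complex.exp_ofReal_mul_I_im] at h2
  simp at h2
  exact h1.ne' h2

/-- Let `h = J G` with `G` outer with boundary data `ω`, where `ω` dominates the logarithms of the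
Poisson kernels at all points `z n` on an arc that starts at `1`. Then `(1 - |z n|²) |G (z n)|` is
asymptotically at least `1`. So if `|J (z n)|` tends to `1`, every upper bound `p n ≤ 1` for
`(1 - |z n|²) |h (z n)|` tends to `1`. -/
theorem tendsto_of_tendsto_norm_inner {t₀ : ℝ} (ht₀ : 0 < t₀) (ht₀π : t₀ ≤ π) {z : ℕ → ℂ}
    (hz : ∀ n, z n ∈ disk) (hzim : ∀ n, 0 < (z n).im) (hzlim : Tendsto z atTop (𝓝 1))
    (hzsum : Summable fun n => (1 - ‖z n‖ ^ 2) / ‖1 - z n‖ ^ 2)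
    {h J G : ℂ → ℂ} {ω : ℂ → ℝ} (hG : IsOuterWith ω G) (hJG : ∀ w ∈ disk, h w = J w * G w)
    (hω : ∀ n, ∀ᵐ t : ℝ, t ∈ Ioo 0 t₀ →
      log (poissonKernel 0 (z n) (circleMap 0 1 t)) ≤ ω (circleMap 0 1 t))
    {p : ℕ → ℝ} (hp1 : ∀ n, p n ≤ 1) (hp : ∀ n, ‖h (z n)‖ * (1 - ‖z n‖ ^ 2) ≤ p n)
    (hJ : Tendsto (fun n => ‖J (z n)‖) atTop (𝓝 1)) : Tendsto p atTop (𝓝 1) := by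
  obtain ⟨-, hG0, hωint, hGω⟩ := hG
  obtain ⟨c, hc, hcz⟩ := exists_mul_norm_one_sub_le ht₀ ht₀π
  -- `κ n` bounds the Poisson kernel at `z n` off the arc
  set κ : ℕ → ℝ := fun n => (1 - ‖z n‖ ^ 2) / ‖1 - z n‖ ^ 2 * (c ^ 2)⁻¹ with hκ
  have hκlim : Tendsto κ atTop (𝓝 0) := by
    simpa using hzsum.tendsto_atTop_zero.mul_const (c ^ 2)⁻¹
  have hκ0 : ∀ n, 0 ≤ κ n := fun n =>
    mul_nonneg (div_nonneg (one_sub_norm_sq_pos (hz n)).le (sq_nonneg _)) (by positivity)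
  set A := circleAverage |ω| 0 1 with hA
  have hlow : ∀ᶠ n in atTop, exp (-(κ n * A)) ≤ ‖G (z n)‖ * (1 - ‖z n‖ ^ 2) := by
    filter_upwards [hzlim.eventually hcz, hκlim.eventually_le_const one_pos] with n h1 h2
    have hpos := one_sub_norm_sq_pos (hz n)
    have hoff : ∀ t ∈ Icc t₀ (2 * π), poissonKernel 0 (z n) (circleMap 0 1 t) ≤ κ n := by
      intro t ht
      have h3 := h1 (hzim n) t ht
      have h4 := norm_one_sub_pos_of_im_pos (hzim n)
      rw [poissonKernel_circleMap]
      have h5 : κ n = (1 - ‖z n‖ ^ 2) / (c * ‖1 - z n‖) ^ 2 := by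
        simp only [hκ]
        rw [mul_pow, div_mul_eq_mul_div, mul_comm (c ^ 2), ← div_div, div_eq_mul_inv _ (c ^ 2),
          div_mul_eq_mul_div]
      rw [h5]
      gcongr
    have h6 := neg_log_sub_le_poissonIntegral hωint (hz n) (hκ0 n) h2 hoff (hω n)
    rw [← hGω _ (hz n)] at h6
    have hGpos : 0 < ‖G (z n)‖ := norm_pos_iff.2 (hG0 _ (hz n))
    rw [← le_log_iff_exp_le (mul_pos hGpos hpos), log_mul hGpos.ne' hpos.ne']
    linarith
  have hleft : Tendsto (fun n => ‖J (z n)‖ * exp (-(κ n * A))) atTop (𝓝 1) := by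
    have h1 : Tendsto (fun n => exp (-(κ n * A))) atTop (𝓝 1) := by
      have h2 := (hκlim.mul_const A).neg
      rw [zero_mul, neg_zero] at h2
      have h3 := (continuous_exp.tendsto 0).comp h2
      rwa [exp_zero] at h3
    simpa using hJ.mul h1
  refine tendsto_of_tendsto_of_tendsto_of_le_of_le' hleft tendsto_const_nhds ?_
    (Eventually.of_forall hp1)
  filter_upwards [hlow] with n hn
  refine le_trans ?_ (hp n)
  rw [hJG _ (hz n), norm_mul, mul_assoc ‖J (z n)‖]
  exact mul_le_mul_of_nonneg_left hn (norm_nonneg _)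

end DiskFun

open DiskFun in
theorem theorem1p4 (t₀ : ℝ) (ht₀ : 0 < t₀) (ht₀π : t₀ ≤ Real.pi)
    (F : ℂ → ℂ) (hF : DiskFun.IsHInfty F) (hFouter : DiskFun.IsOuter F)
    (hFnorm : DiskFun.HasSupNorm F 1)
    (hF' : DiskFun.InDiskAlgebra (deriv F))
    (hFE : ∀ t ∈ Set.Icc 0 t₀,
      Tendsto (fun r : ℝ => ‖F (r * Complex.exp (t * Complex.I))‖) (𝓝[<] 1) (𝓝 1))
    (z : ℕ → ℂ) (hz : ∀ n, z n ∈ DiskFun.disk) (hthick : DiskFun.IsThick z)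
    (hzim : ∀ n, 0 < (z n).im) (hzlim : Tendsto z atTop (𝓝 1))
    (hzsum : Summable fun n => (1 - ‖z n‖ ^ 2) / ‖1 - z n‖ ^ 2)
    (hB' : DiskFun.IsSmirnov (deriv (DiskFun.blaschkeProduct z)))
    (f : ℂ → ℂ) (hf : ∀ w ∈ DiskFun.disk, f w = DiskFun.blaschkeProduct z w * F w) :
    DiskFun.IsSmirnov (deriv f) ∧
      ∃ J : ℂ → ℂ, DiskFun.IsInnerFactor J (deriv f) ∧ DiskFun.IsNonconstant J ∧
        (1 : ℂ) ∈ DiskFun.boundarySpectrum J := by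
  have hs := summable_one_sub_norm hz hzim hzsum
  have hBd : DifferentiableOn ℂ (blaschkeProduct z) disk :=
    differentiableOn_tprod_blaschkeFactor hz hs
  have hB1 : ∀ w ∈ disk, ‖blaschkeProduct z w‖ ≤ 1 := fun w hw =>
    norm_tprod_blaschkeFactor_le_one hz hs hw
  have hfd : DifferentiableOn ℂ f disk := (hBd.mul hF.1).congr hf
  have hsmirnov : IsSmirnov (deriv f) := by
    have hB : IsHInfty (blaschkeProduct z) := ⟨hBd, 1, hB1⟩
    refine ((hB'.mul hF.isSmirnov).add (hB.isSmirnov.mul hF'.isHInfty.isSmirnov)).congr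
      fun w hw => ?_
    rw [deriv_eq_of_eqOn_disk hf hw]
    exact deriv_fun_mul (hBd.differentiableAt (isOpen_disk.mem_nhds hw))
      (hF.1.differentiableAt (isOpen_disk.mem_nhds hw))
  -- the radial limits of `f` on the arc have modulus one
  have hfrad : ∀ t ∈ Set.Ioo 0 t₀,
      Tendsto (fun r : ℝ => ‖f (circleMap 0 r t)‖) (𝓝[<] 1) (𝓝 1) := by
    intro t ht
    have h1 := (tendsto_norm_blaschkeProduct hz hs hzlim (ne_one_of_mem_arc ht₀π ht)).mul
      (hFE t (Set.Ioo_subset_Icc_self ht))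
    rw [one_mul] at h1
    refine h1.congr' ?_
    filter_upwards [Ioo_mem_nhdsLT (show (0 : ℝ) < 1 by norm_num)] with r hr
    rw [hf _ (circleMap_mem_disk hr.1.le hr.2 t), norm_mul, circleMap_zero]
  -- the Blaschke product without its `k`-th factor
  set g : ℕ → ℂ → ℂ := fun k w => ∏' j : {j : ℕ // j ≠ k}, blaschkeFactor (z j) w
  have hs' : ∀ k, Summable fun j : {j : ℕ // j ≠ k} => 1 - ‖z j‖ := fun k =>
    hs.comp_injective Subtype.val_injective
  have hg1 : ∀ k, ∀ w ∈ disk, ‖g k w‖ ≤ 1 := fun k w hw =>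
    norm_tprod_blaschkeFactor_le_one (z := fun j : {j : ℕ // j ≠ k} => z j) (fun j => hz j)
      (hs' k) hw
  have hgd : ∀ k, DifferentiableOn ℂ (g k) disk := fun k =>
    differentiableOn_tprod_blaschkeFactor (fun j => hz j) (hs' k)
  have hfg : ∀ k, ∀ w ∈ disk, f w = blaschkeFactor (z k) w * (g k w * F w) := fun k w hw => by
    rw [hf w hw, blaschkeProduct_eq_mul hz hs k hw, mul_assoc]
  have hgF1 : ∀ k, ∀ w ∈ disk, ‖g k w * F w‖ ≤ ‖g k w‖ := fun k w hw => by
    rw [norm_mul]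
    exact mul_le_of_le_one_right (norm_nonneg _) (hFnorm.norm_le hw)
  have hfz : ∀ k, ∀ w ∈ disk, ‖f w‖ ≤ pseudoDist (z k) w := fun k w hw => by
    rw [hfg k w hw, norm_mul, norm_blaschkeFactor]
    exact mul_le_of_le_one_right (pseudoDist_nonneg _ _) ((hgF1 k w hw).trans (hg1 k w hw))
  have hderiv : ∀ k, ‖deriv f (z k)‖ * (1 - ‖z k‖ ^ 2) ≤ ‖g k (z k)‖ := fun k => by
    rw [deriv_eq_of_eqOn_disk (hfg k) (hz k), norm_deriv_blaschkeFactor_mul (hz k)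
      (((hgd k).fun_mul hF.1).differentiableAt (isOpen_disk.mem_nhds (hz k)))]
    exact hgF1 k _ (hz k)
  -- `f` vanishes at `z 0` but has radial limits of modulus one, so it is not constant
  have hne : ∃ w ∈ disk, deriv f w ≠ 0 := by
    by_contra! hcon
    have h0 : ∀ w ∈ disk, f w = 0 := fun w hw => by
      rw [isOpen_disk.is_const_of_deriv_eq_zero (convex_ball _ _).isPreconnected hfd
        (fun w hw => hcon w hw) hw (hz 0), hfg 0 _ (hz 0)]
      simp [blaschkeFactor]
    have h1 := hfrad (t₀ / 2) ⟨by linarith, by linarith⟩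
    have h2 : Tendsto (fun r : ℝ => ‖f (circleMap 0 r (t₀ / 2))‖) (𝓝[<] 1) (𝓝 0) := by
      refine tendsto_const_nhds.congr' ?_
      filter_upwards [Ioo_mem_nhdsLT (show (0 : ℝ) < 1 by norm_num)] with r hr
      rw [h0 _ (circleMap_mem_disk hr.1.le hr.2 _), norm_zero]
    exact one_ne_zero (tendsto_nhds_unique h1 h2)
  obtain ⟨J, G, ω, hJ, hG, hJG⟩ := hsmirnov.exists_inner_outer hne
  have hω : ∀ n, ∀ᵐ t : ℝ, t ∈ Set.Ioo 0 t₀ →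
      Real.log (poissonKernel 0 (z n) (circleMap 0 1 t)) ≤ ω (circleMap 0 1 t) := fun n => by
    filter_upwards [ae_tendsto_norm_of_inner_outer hJ hG hJG] with t ht htE
    rw [Real.log_le_iff_le_exp (poissonKernel_circleMap_pos (hz n) t)]
    exact poissonKernel_le_of_radial hfd (hz n) (hfz n) (hfrad t htE) ht
  have hspec : (1 : ℂ) ∈ boundarySpectrum J := by
    refine ⟨norm_one, fun ⟨q, hq, hqJ⟩ => hthick ?_⟩
    have hJz : Tendsto (fun n => ‖J (z n)‖) atTop (𝓝 1) :=
      (hJ.tendsto_norm_of_continuation hq hqJ).comp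
        (tendsto_nhdsWithin_iff.2 ⟨hzlim, Eventually.of_forall hz⟩)
    have hp := tendsto_of_tendsto_norm_inner ht₀ ht₀π hz hzim hzlim hzsum hG hJG hω
      (p := fun k => ‖g k (z k)‖) (fun k => hg1 k _ (hz k)) hderiv hJz
    exact hp.congr fun k => norm_tprod_blaschkeFactor
      (z := fun j : {j : ℕ // j ≠ k} => z j) (fun j => hz j) (hs' k) (hz k)
  refine ⟨hsmirnov, J, ⟨hJ, G, isOuter_iff.2 ⟨ω, hG⟩, hJG⟩, fun ⟨c, hc⟩ => ?_, hspec⟩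
  exact hspec.2 ⟨fun _ => c, analyticAt_const, by
    filter_upwards [self_mem_nhdsWithin] with w hw
    exact (hc w hw).symm⟩
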